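/- Let $n\in\mathbb N_0$, $s>1$ and $1\le p,q\le\infty$. Let $\rho:\mathbb R^n\to[0,1]$ be a smooth function with support in the cube $\{\xi:\ |\xi_i|\le 1,\ i=1,\dots,n\}$ and with $\rho(\xi)=1$ whenever $|\xi_i|\le\frac12$ for $i=1,\dots,n$. For $k\in\mathbb Z^n$ put $$\sigma_k(\xi)=\rho(\xi-k)\Big(\sum_{j\in\mathbb Z^n}\rho(\xi-j)\Big)^{-1},\qquad \Box_k f=\mathcal F^{-1}(\sigma_k\,\mathcal F f)\quad (f\in\mathcal S'(\mathbb R^n)),$$ where $\mathcal F f(\xi)=(2\pi)^{-n/2}\int_{\mathbb R^n}f(x)e^{-i x\cdot\xi}\,dx$. The Gevrey-modulation space $\mathcal{GM}^s_{p,q}(\mathbb R^n)$ is the set of all complex-valued $f\in L^p(\mathbb R^n)$ such that $$\|f\|_{\mathcal{GM}^s_{p,q}}=\Big(\sum_{k\in\mathbb Z^n}e^{q|k|^{1/s}}\,\|\Box_k f\|_{L^p}^q\Big)^{1/q}<\infty$$ (with a supremum over $k$ in place of the sum if $q=\infty$), where $|k|$ is the Euclidean norm. Then $\mathcal{GM}^s_{p,q}(\mathbb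 R^n)$ is a Banach algebra under pointwise multiplication: $\|\cdot\|_{\mathcal{GM}^s_{p,q}}$ is a complete norm on it, and there is a constant $C>0$ (depending on $\rho,n,s,p,q$ only) such that for all $f,g\in\mathcal{GM}^s_{p,q}(\mathbb R^n)$ the pointwise product $f\cdot g$ belongs to $\mathcal{GM}^s_{p,q}(\mathbb R^n)$ and $$\|f\cdot g\|_{\mathcal{GM}^s_{p,q}}\le C\,\|f\|_{\mathcal{GM}^s_{p,q}}\,\|g\|_{\mathcal{GM}^s_{p,q}}.$$ -/

import Mathlib

open MeasureTheory
open scoped ENNReal NNReal SchwartzMap ContDiff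

noncomputable section

namespace GevreyModulation

/-- `ℝⁿ` with its Euclidean norm. -/
abbrev E (n : ℕ) : Type := EuclideanSpace ℝ (Fin n)

/-- The lattice point `k ∈ ℤⁿ`, as a vector of `ℝⁿ`. -/
def latticePt {n : ℕ} (k : Fin n → ℤ) : E n := WithLp.toLp 2 fun i => (k i : ℝ)

/-- A window for the frequency-uniform decomposition: a smooth function `ρ : ℝⁿ → [0,1]`, supported
in the cube `|ξᵢ| ≤ 1`, with `ρ = 1` on the cube `|ξᵢ| ≤ 1/2`. -/
structure IsWindow {n : ℕ} (ρ : E n → ℝ) : Prop where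
  contDiff : ContDiff ℝ ∞ ρ
  nonneg : ∀ ξ, 0 ≤ ρ ξ
  le_one : ∀ ξ, ρ ξ ≤ 1
  tsupport_subset : tsupport ρ ⊆ {ξ | ∀ i, |ξ i| ≤ 1}
  eq_one : ∀ ξ : E n, (∀ i, |ξ i| ≤ 1 / 2) → ρ ξ = 1

/-- The uniform decomposition of unity `σ_k(ξ) = ρ(ξ - k) / ∑_{j ∈ ℤⁿ} ρ(ξ - j)`; for a window `ρ`
the sum over `j` has only finitely many nonzero terms for each `ξ`. -/
def sigma {n : ℕ} (ρ : E n → ℝ) (k : Fin n → ℤ) (ξ : E n) : ℝ :=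
  ρ (ξ - latticePt k) / ∑' j : Fin n → ℤ, ρ (ξ - latticePt j)

/-- The uniform decomposition operator `□_k = 𝓕⁻¹ (σ_k 𝓕 ·)` on tempered distributions, for the
Fourier transform `(2π)^(-n/2) ∫ f(x) e^{-i x·ξ} dx`. Mathlib's Fourier transform has the kernel
`e^{-2πi x·ζ}`, so that the frequency `ξ` corresponds to `ζ = ξ / (2π)` and the multiplier is
`ζ ↦ σ_k (2π ζ)`. -/
def box {n : ℕ} (ρ : E n → ℝ) (k : Fin n → ℤ) : 𝓢'(E n, ℂ) →L[ℂ] 𝓢'(E n, ℂ) :=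
  TemperedDistribution.fourierMultiplierCLM ℂ
    (fun ζ : E n => ((sigma ρ k ((2 * Real.pi) • ζ) : ℝ) : ℂ))

/-- The `L^p` norm of a tempered distribution: the norm of the (unique) `L^p` function that
represents it, and `∞` if there is none. -/
def lpENorm {n : ℕ} (p : ℝ≥0∞) [Fact (1 ≤ p)] (T : 𝓢'(E n, ℂ)) : ℝ≥0∞ :=
  ⨅ g : {g : Lp ℂ p (volume : Measure (E n)) // (g : 𝓢'(E n, ℂ)) = T}, ‖g.1‖ₑ

/-- The weight `e^{|k|^{1/s}}`, with `|k|` the Euclidean norm. -/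
def weight {n : ℕ} (s : ℝ) (k : Fin n → ℤ) : ℝ≥0 :=
  Real.toNNReal (Real.exp (‖latticePt k‖ ^ (1 / s)))

/-- The (possibly infinite) Gevrey-modulation norm: the `ℓ^q(ℤⁿ)` norm of the sequence
`k ↦ e^{|k|^{1/s}} ‖□_k f‖_{L^p}`. -/
def gmENorm {n : ℕ} (ρ : E n → ℝ) (s : ℝ) (p q : ℝ≥0∞) [Fact (1 ≤ p)]
    (f : Lp ℂ p (volume : Measure (E n))) : ℝ≥0∞ :=
  eLpNorm (fun k : Fin n → ℤ => (weight s k : ℝ≥0∞) * lpENorm p (box ρ k (f : 𝓢'(E n, ℂ))))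
    q Measure.count


theorem toTD_zero {n : ℕ} (p : ℝ≥0∞) [Fact (1 ≤ p)] :
    ((0 : Lp ℂ p (volume : Measure (E n))) : 𝓢'(E n, ℂ)) = 0 :=
  map_zero (Lp.toTemperedDistributionCLM ℂ volume p)

theorem toTD_add {n : ℕ} {p : ℝ≥0∞} [Fact (1 ≤ p)] (f g : Lp ℂ p (volume : Measure (E n))) :
    ((f + g : Lp ℂ p (volume : Measure (E n))) : 𝓢'(E n, ℂ)) =
      (f : 𝓢'(E n, ℂ)) + (g : 𝓢'(E n, ℂ)) :=
  map_add (Lp.toTemperedDistributionCLM ℂ volume p) f g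

theorem toTD_smul {n : ℕ} {p : ℝ≥0∞} [Fact (1 ≤ p)] (c : ℂ)
    (f : Lp ℂ p (volume : Measure (E n))) :
    ((c • f : Lp ℂ p (volume : Measure (E n))) : 𝓢'(E n, ℂ)) = c • (f : 𝓢'(E n, ℂ)) :=
  map_smul (Lp.toTemperedDistributionCLM ℂ volume p) c f

theorem lpENorm_zero {n : ℕ} (p : ℝ≥0∞) [Fact (1 ≤ p)] :
    lpENorm p (0 : 𝓢'(E n, ℂ)) = 0 := by
  refine le_antisymm ?_ bot_le
  refine (iInf_le _ ⟨0, toTD_zero p⟩).trans ?_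
  simp

theorem lpENorm_add_le {n : ℕ} (p : ℝ≥0∞) [Fact (1 ≤ p)] (S T : 𝓢'(E n, ℂ)) :
    lpENorm p (S + T) ≤ lpENorm p S + lpENorm p T := by
  refine ENNReal.le_iInf_add_iInf fun a b => ?_
  have h : ((a.1 + b.1 : Lp ℂ p (volume : Measure (E n))) : 𝓢'(E n, ℂ)) = S + T := by
    rw [toTD_add, a.2, b.2]
  exact (iInf_le _ (Subtype.mk (a.1 + b.1) h)).trans (enorm_add_le a.1 b.1)

theorem lpENorm_smul_le {n : ℕ} (p : ℝ≥0∞) [Fact (1 ≤ p)] (c : ℂ) (T : 𝓢'(E n, ℂ)) :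
    lpENorm p (c • T) ≤ ‖c‖ₑ * lpENorm p T := by
  rcases eq_or_ne c 0 with rfl | hc
  · have h : (0 : ℂ) • T = 0 := by ext u; simp
    rw [h, lpENorm_zero]
    exact bot_le
  · unfold lpENorm
    rw [ENNReal.mul_iInf_of_ne (by simpa using hc) (by simp)]
    refine le_iInf fun a => ?_
    have h : ((c • a.1 : Lp ℂ p (volume : Measure (E n))) : 𝓢'(E n, ℂ)) = c • T := by
      rw [toTD_smul, a.2]
    exact (iInf_le _ (Subtype.mk (c • a.1) h)).trans (enorm_smul c a.1).le

theorem gmENorm_zero {n : ℕ} (ρ : E n → ℝ) (s : ℝ) (p q : ℝ≥0∞) [Fact (1 ≤ p)] :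
    gmENorm ρ s p q 0 = 0 := by
  simp [gmENorm, toTD_zero, lpENorm_zero]

theorem gmENorm_add_le {n : ℕ} (ρ : E n → ℝ) (s : ℝ) (p q : ℝ≥0∞) [Fact (1 ≤ p)] [Fact (1 ≤ q)]
    (f g : Lp ℂ p (volume : Measure (E n))) :
    gmENorm ρ s p q (f + g) ≤ gmENorm ρ s p q f + gmENorm ρ s p q g := by
  unfold gmENorm
  refine le_trans (eLpNorm_mono_enorm fun k => ?_) (eLpNorm_add_le
    (Measurable.of_discrete).aestronglyMeasurable
    (Measurable.of_discrete).aestronglyMeasurable Fact.out)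
  simp only [toTD_add, map_add, enorm_eq_self, Pi.add_apply, ← mul_add]
  gcongr
  exact lpENorm_add_le _ _ _

theorem gmENorm_smul_le {n : ℕ} (ρ : E n → ℝ) (s : ℝ) (p q : ℝ≥0∞) [Fact (1 ≤ p)]
    (c : ℂ) (f : Lp ℂ p (volume : Measure (E n))) :
    gmENorm ρ s p q (c • f) ≤ ‖c‖ₑ * gmENorm ρ s p q f := by
  unfold gmENorm
  refine eLpNorm_le_nnreal_smul_eLpNorm_of_ae_le_mul' (c := ‖c‖₊)
    (Filter.Eventually.of_forall fun k => ?_) q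
  simp only [toTD_smul, map_smul, enorm_eq_self]
  rw [mul_left_comm]
  gcongr
  exact lpENorm_smul_le _ _ _

/-- The Gevrey-modulation space: all `f ∈ L^p(ℝⁿ)` with finite Gevrey-modulation norm. -/
def GM {n : ℕ} (ρ : E n → ℝ) (s : ℝ) (p q : ℝ≥0∞) [Fact (1 ≤ p)] [Fact (1 ≤ q)] :
    Submodule ℂ (Lp ℂ p (volume : Measure (E n))) where
  carrier := {f | gmENorm ρ s p q f < ⊤}
  zero_mem' := by simp [gmENorm_zero]
  add_mem' hf hg := (gmENorm_add_le ρ s p q _ _).trans_lt (ENNReal.add_lt_top.2 ⟨hf, hg⟩)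
  smul_mem' c _ hf :=
    (gmENorm_smul_le ρ s p q c _).trans_lt (ENNReal.mul_lt_top enorm_lt_top hf)

theorem GM_lt_top {n : ℕ} {ρ : E n → ℝ} {s : ℝ} {p q : ℝ≥0∞} [Fact (1 ≤ p)] [Fact (1 ≤ q)]
    (f : GM ρ s p q) : gmENorm ρ s p q f.1 < ⊤ := f.2

/-- The Gevrey-modulation norm on the Gevrey-modulation space. -/
def gmNorm {n : ℕ} (ρ : E n → ℝ) (s : ℝ) (p q : ℝ≥0∞) [Fact (1 ≤ p)] [Fact (1 ≤ q)] :
    Seminorm ℂ (GM ρ s p q) :=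
  Seminorm.ofSMulLE (fun f => (gmENorm ρ s p q f.1).toReal)
    (by simp [gmENorm_zero])
    (fun f g => by
      rw [← ENNReal.toReal_add (ne_of_lt (GM_lt_top f)) (ne_of_lt (GM_lt_top g))]
      exact ENNReal.toReal_mono (ENNReal.add_lt_top.2 ⟨GM_lt_top f, GM_lt_top g⟩).ne
        (gmENorm_add_le ρ s p q f.1 g.1))
    (fun c f => by
      rw [← toReal_enorm c, ← ENNReal.toReal_mul]
      exact ENNReal.toReal_mono (ENNReal.mul_lt_top enorm_lt_top (GM_lt_top f)).ne
        (gmENorm_smul_le ρ s p q c f.1))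

end GevreyModulation

end

noncomputable section

/-! Each `□_k` is convolution with an integrable kernel. The sum of the translates of `ρ` is
periodic, so the symbols are translates of one another, the kernels differ only by a unimodular
factor and a shift of phase, and all bounds are uniform in `k`. Since `∑ e^{-|k|^{1/s}}` converges,
finiteness of the norm makes `∑ ‖□_k f‖_p` converge. The sum is `f`, because a function all of whose
boxes vanish is zero (`hasSum_boxLp`). Hence the space embeds in `L^p`, which gives definiteness;
completeness follows from completeness of `L^p` and Fatou's lemma in `ℓ^q`.

For products, Bernstein's inequality bounds `‖□_k f‖_∞` by `‖□_k f‖_p`, so `f` is bounded, `f g`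
lies in `L^p`, and `f g = ∑ □_k f · □_l g`. Spectra add (`multLp_mul_eq_zero`), so `□_m` sees only
the pairs with `m - k - l` in a fixed finite cube, and `‖□_m (f g)‖_p` is bounded by finitely many
shifts of a discrete convolution.

What remains is a weighted `ℓ^q` estimate (`eLpNorm_weight_conv_le`). Strict concavity of `x ↦
x^{1/s}` makes the weight better than submultiplicative: the smaller of the two frequencies
contributes an extra factor `e^{-c|k|^{1/s}}` with `c = 2 - 2^{1/s} > 0`. This factor is summable,
so it turns one of the `ℓ^q` sequences into an `ℓ^1` sequence, and Young's inequality `ℓ^1 * ℓ^q ⊆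
ℓ^q` applies for every `q`. -/

namespace GevreyModulation


/-! ### Young's inequality on a group, used for Lebesgue measure on `ℝⁿ` and for counting measure on
`ℤⁿ`. -/

section Young

variable {G : Type*} [AddCommGroup G] [MeasurableSpace G] [MeasurableAdd₂ G] [MeasurableNeg G]
  {μ : Measure G} [SFinite μ] [μ.IsAddLeftInvariant] [μ.IsNegInvariant]

/-- Young's inequality `L¹ * L^p ⊆ L^p` for nonnegative functions. -/
theorem eLpNorm_lintegral_conv_le {k F : G → ℝ≥0∞} (hk : Measurable k) (hF : AEMeasurable F μ)
    (hk' : ∫⁻ x, k x ∂μ ≠ ⊤) {p : ℝ≥0∞} (hp : 1 ≤ p) :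
    eLpNorm (fun x => ∫⁻ y, k (x - y) * F y ∂μ) p μ ≤ (∫⁻ x, k x ∂μ) * eLpNorm F p μ := by
  have hkx (x : G) : ∫⁻ y, k (x - y) ∂μ = ∫⁻ y, k y ∂μ := lintegral_sub_left_eq_self k x
  have hky (y : G) : ∫⁻ x, k (x - y) ∂μ = ∫⁻ y, k y ∂μ := lintegral_sub_right_eq_self k y
  rcases eq_or_ne p ⊤ with rfl | hp_top
  · rw [eLpNorm_exponent_top, eLpNorm_exponent_top]
    refine eLpNormEssSup_le_of_ae_enorm_bound (Filter.Eventually.of_forall fun x => ?_)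
    rw [enorm_eq_self, ← hkx x, ← lintegral_mul_const _ (by fun_prop)]
    refine lintegral_mono_ae ?_
    filter_upwards [ae_le_eLpNormEssSup (f := F) (μ := μ)] with y hy
    gcongr
    simpa using hy
  have hp0 : p ≠ 0 := (one_pos.trans_le hp).ne'
  have hr : 0 < p.toReal := ENNReal.toReal_pos hp0 hp_top
  have hr1 : 1 ≤ p.toReal := by simpa using ENNReal.toReal_mono hp_top hp
  set κ := ∫⁻ x, k x ∂μ with hκ
  -- Jensen's inequality for the measure `k(x - y) dy` of total mass `κ`, in the form of the
  -- comparison of its `L^1` and `L^p` norms. Integration in `x` and Tonelli then finish the proof.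
  have key (x : G) : (∫⁻ y, k (x - y) * F y ∂μ) ^ p.toReal
      ≤ κ ^ (p.toReal - 1) * ∫⁻ y, k (x - y) * F y ^ p.toReal ∂μ := by
    have hm : Measurable fun y => k (x - y) := by fun_prop
    have hF' : AEMeasurable F (μ.withDensity fun y => k (x - y)) :=
      hF.mono_ac (withDensity_absolutelyContinuous _ _)
    have h := eLpNorm_le_eLpNorm_mul_rpow_measure_univ (μ := μ.withDensity fun y => k (x - y))
      (f := F) hp hF'.aestronglyMeasurable
    rw [eLpNorm_one_eq_lintegral_enorm, eLpNorm_eq_lintegral_rpow_enorm_toReal hp0 hp_top,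
      withDensity_apply _ MeasurableSet.univ, Measure.restrict_univ, hkx] at h
    simp only [enorm_eq_self] at h
    rw [lintegral_withDensity_eq_lintegral_mul₀ hm.aemeasurable hF,
      lintegral_withDensity_eq_lintegral_mul₀ hm.aemeasurable (hF.pow_const _)] at h
    simp only [Pi.mul_apply] at h
    have h2 := ENNReal.rpow_le_rpow h hr.le
    rw [ENNReal.mul_rpow_of_nonneg _ _ hr.le, ← ENNReal.rpow_mul, ← ENNReal.rpow_mul] at h2
    refine h2.trans (le_of_eq ?_)
    rw [mul_comm]
    congr 1
    · congr 1
      field_simp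
      simp [mul_sub]
    · field_simp
      simp
  rw [eLpNorm_eq_lintegral_rpow_enorm_toReal hp0 hp_top,
    eLpNorm_eq_lintegral_rpow_enorm_toReal hp0 hp_top]
  simp only [enorm_eq_self]
  have hmeas : AEMeasurable (Function.uncurry fun x y => k (x - y) * F y ^ p.toReal)
      (μ.prod μ) := by
    refine AEMeasurable.mul (by fun_prop) ?_
    exact ((hF.comp_snd).pow_const _)
  calc (∫⁻ x, (∫⁻ y, k (x - y) * F y ∂μ) ^ p.toReal ∂μ) ^ (1 / p.toReal)
      ≤ (∫⁻ x, κ ^ (p.toReal - 1) * ∫⁻ y, k (x - y) * F y ^ p.toReal ∂μ ∂μ) ^ (1 / p.toReal) := by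
        gcongr with x
        exact key x
    _ = (κ ^ (p.toReal - 1) * (κ * ∫⁻ y, F y ^ p.toReal ∂μ)) ^ (1 / p.toReal) := by
        rw [lintegral_const_mul' _ _ (ENNReal.rpow_ne_top_of_nonneg (by linarith) hk'),
          lintegral_lintegral_swap hmeas]
        congr 2
        rw [← lintegral_const_mul'' _ (hF.pow_const _)]
        refine lintegral_congr fun y => ?_
        rw [lintegral_mul_const _ (by fun_prop), hky]
    _ = κ * (∫⁻ y, F y ^ p.toReal ∂μ) ^ (1 / p.toReal) := by
        rw [← mul_assoc, ENNReal.mul_rpow_of_nonneg _ _ (by positivity)]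
        congr 1
        nth_rewrite 2 [← ENNReal.rpow_one κ]
        rw [← ENNReal.rpow_add_of_nonneg _ _ (by linarith) zero_le_one, sub_add_cancel,
          ← ENNReal.rpow_mul, mul_one_div_cancel hr.ne', ENNReal.rpow_one]

end Young

/-! ### Convolution of an `L^p` function with a continuous kernel. -/

section Convolution

variable {V : Type*} [NormedAddCommGroup V] [InnerProductSpace ℝ V] [FiniteDimensional ℝ V]
  [MeasurableSpace V] [BorelSpace V]

/-- Convolution with a kernel, `x ↦ ∫ K(x - y) f(y) dy`. -/
def kconv (K f : V → ℂ) (x : V) : ℂ := ∫ y, K (x - y) * f y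

theorem aestronglyMeasurable_kconv {K f : V → ℂ} (hK : Continuous K)
    (hf : AEStronglyMeasurable f volume) : AEStronglyMeasurable (kconv K f) volume := by
  have : AEStronglyMeasurable (fun z : V × V => K (z.1 - z.2) * f z.2) (volume.prod volume) :=
    (by fun_prop : Continuous fun z : V × V => K (z.1 - z.2)).aestronglyMeasurable.mul
      hf.comp_snd
  exact this.integral_prod_right'

theorem enorm_kconv_le_lintegral (K f : V → ℂ) (x : V) :
    ‖kconv K f x‖ₑ ≤ ∫⁻ y, ‖K (x - y)‖ₑ * ‖f y‖ₑ := by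
  refine (enorm_integral_le_lintegral_enorm _).trans_eq ?_
  simp

theorem lintegral_kernel_mul_le {K f : V → ℂ} (hK : Continuous K)
    (hf : AEStronglyMeasurable f volume) (p q : ℝ≥0∞) [p.HolderConjugate q] (x : V) :
    ∫⁻ y, ‖K (x - y)‖ₑ * ‖f y‖ₑ ≤ eLpNorm K q volume * eLpNorm f p volume := by
  have hKx : Continuous fun y => K (x - y) := by fun_prop
  have h := eLpNorm_smul_le_mul_eLpNorm (p := q) (q := p) (r := 1) hf hKx.aestronglyMeasurable
  rw [eLpNorm_one_eq_lintegral_enorm] at h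
  simp only [Pi.smul_apply', smul_eq_mul, enorm_mul] at h
  refine h.trans_eq ?_
  congr 1
  exact eLpNorm_comp_measurePreserving (g := K) hK.aestronglyMeasurable
    (Measure.measurePreserving_sub_left volume x)

theorem enorm_kconv_le {K f : V → ℂ} (hK : Continuous K)
    (hf : AEStronglyMeasurable f volume) (p q : ℝ≥0∞) [p.HolderConjugate q] (x : V) :
    ‖kconv K f x‖ₑ ≤ eLpNorm K q volume * eLpNorm f p volume :=
  (enorm_kconv_le_lintegral K f x).trans (lintegral_kernel_mul_le hK hf p q x)

theorem eLpNorm_kconv_le {K f : V → ℂ} (hK : Continuous K) (hK' : Integrable K)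
    (hf : AEStronglyMeasurable f volume) {p : ℝ≥0∞} (hp : 1 ≤ p) :
    eLpNorm (kconv K f) p volume ≤ eLpNorm K 1 volume * eLpNorm f p volume := by
  have h := eLpNorm_lintegral_conv_le (μ := (volume : Measure V)) (k := fun x => ‖K x‖ₑ)
    (F := fun y => ‖f y‖ₑ) (by fun_prop) hf.enorm hK'.2.ne hp
  rw [eLpNorm_one_eq_lintegral_enorm]
  refine (eLpNorm_mono_enorm fun x => ?_).trans (h.trans_eq ?_)
  · simpa using enorm_kconv_le_lintegral K f x
  · rw [eLpNorm_enorm]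

/-- Fubini. Hölder's inequality bounds the inner integral uniformly in `x`, and `W` supplies the
integrability in `x`. -/
theorem integral_kconv_mul {K f W : V → ℂ} (hK : Continuous K)
    {p q : ℝ≥0∞} [p.HolderConjugate q] (hKq : MemLp K q volume) (hf : MemLp f p volume)
    (hW : Integrable W) :
    ∫ x, kconv K f x * W x = ∫ y, f y * ∫ x, K (x - y) * W x := by
  have hint : Integrable (Function.uncurry fun x y : V => K (x - y) * f y * W x)
      (volume.prod volume) := by
    refine ⟨((by fun_prop : Continuous fun z : V × V => K (z.1 - z.2)).aestronglyMeasurable.mul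
      hf.1.comp_snd).mul hW.1.comp_fst, ?_⟩
    refine (lintegral_prod_le _).trans_lt ?_
    have hle (x : V) : ∫⁻ y, ‖K (x - y) * f y * W x‖ₑ
        ≤ (eLpNorm K q volume * eLpNorm f p volume) * ‖W x‖ₑ := by
      simp only [enorm_mul]
      rw [lintegral_mul_const' _ _ enorm_ne_top]
      gcongr
      exact lintegral_kernel_mul_le hK hf.1 p q x
    refine (lintegral_mono hle).trans_lt ?_
    rw [lintegral_const_mul' _ _ (ENNReal.mul_ne_top hKq.2.ne hf.2.ne)]
    exact ENNReal.mul_lt_top (ENNReal.mul_lt_top hKq.2 hf.2) hW.2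
  calc ∫ x, kconv K f x * W x = ∫ x, ∫ y, K (x - y) * f y * W x := by
        refine integral_congr_ae (Filter.Eventually.of_forall fun x => ?_)
        simp only [kconv, integral_mul_const]
    _ = ∫ y, ∫ x, K (x - y) * f y * W x := integral_integral_swap hint
    _ = _ := by
        refine integral_congr_ae (Filter.Eventually.of_forall fun y => ?_)
        simp only [← integral_const_mul]
        congr 1 with x
        ring

end Convolution



/-! ### Fourier multipliers with Schwartz symbol on `L^p`, and the spectrum of a product. -/

section Multiplier

open FourierTransform Real

variable {V : Type*} [NormedAddCommGroup V] [InnerProductSpace ℝ V] [FiniteDimensional ℝ V]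
  [MeasurableSpace V] [BorelSpace V]

/-- `W` is only assumed integrable because it will later be a bounded function times a Schwartz
function, which need not be smooth. -/
theorem integral_fourierInv_kernel_mul (M : 𝓢(V, ℂ)) {W : V → ℂ} (hW : Integrable W) (y : V) :
    ∫ x, (𝓕⁻ M) (x - y) * W x = 𝓕 (fun ξ => M ξ * 𝓕⁻ W ξ) y := by
  have hint : Integrable (Function.uncurry fun x ξ : V =>
      ((𝐞 (inner ℝ ξ (x - y)) : Circle) : ℂ) * (W x * M ξ)) (volume.prod volume) := by
    refine Integrable.bdd_mul (c := 1) (hW.mul_prod M.integrable) ?_ ?_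
    · refine Continuous.aestronglyMeasurable ?_
      have : Continuous fun z : V × V => inner ℝ z.2 (z.1 - y) := by fun_prop
      exact continuous_subtype_val.comp (continuous_fourierChar.comp this)
    · exact Filter.Eventually.of_forall fun z => (Circle.norm_coe _).le
  calc ∫ x, (𝓕⁻ M) (x - y) * W x
      = ∫ x, ∫ ξ, ((𝐞 (inner ℝ ξ (x - y)) : Circle) : ℂ) * (W x * M ξ) := by
        congr 1 with x
        rw [SchwartzMap.fourierInv_coe, Real.fourierInv_eq, ← integral_mul_const]
        congr 1 with ξ
        rw [Circle.smul_def, smul_eq_mul]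
        ring
    _ = ∫ ξ, ∫ x, ((𝐞 (inner ℝ ξ (x - y)) : Circle) : ℂ) * (W x * M ξ) :=
        integral_integral_swap hint
    _ = _ := by
        rw [Real.fourier_eq]
        congr 1 with ξ
        rw [Real.fourierInv_eq, Circle.smul_def, smul_eq_mul, ← integral_const_mul,
          ← integral_const_mul]
        congr 1 with x
        rw [Circle.smul_def, smul_eq_mul, inner_sub_right, sub_eq_add_neg, AddChar.map_add_eq_mul,
          real_inner_comm ξ x]
        push_cast
        ring

theorem integral_kconv_fourierInv_mul {p : ℝ≥0∞} (hp : 1 ≤ p) (M : 𝓢(V, ℂ)) {f W : V → ℂ}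
    (hf : MemLp f p volume) (hW : Integrable W) :
    ∫ x, kconv (𝓕⁻ M : 𝓢(V, ℂ)) f x * W x
      = ∫ y, f y * 𝓕 (fun ξ => M ξ * 𝓕⁻ W ξ) y := by
  -- In `ℝ≥0∞` the expression `(1 - p⁻¹)⁻¹` is the conjugate exponent at the endpoints too: `⊤` for
  -- `p = 1` and `1` for `p = ⊤`.
  have := ENNReal.HolderConjugate.inv_one_sub_inv' hp
  rw [integral_kconv_mul (p := p) (q := (1 - p⁻¹)⁻¹) (𝓕⁻ M : 𝓢(V, ℂ)).continuous
    ((𝓕⁻ M : 𝓢(V, ℂ)).memLp _) hf hW]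
  simp only [integral_fourierInv_kernel_mul M hW]

theorem fourier_smulLeft_apply (M φ : 𝓢(V, ℂ)) (y : V) :
    (𝓕 (SchwartzMap.smulLeftCLM ℂ (M : V → ℂ) (𝓕⁻ φ))) y = 𝓕 (fun ξ => M ξ * 𝓕⁻ (φ : V → ℂ) ξ) y := by
  rw [SchwartzMap.fourier_coe]
  refine congrArg (fun F : V → ℂ => 𝓕 F y) (funext fun ξ => ?_)
  rw [SchwartzMap.smulLeftCLM_apply_apply M.hasTemperateGrowth, smul_eq_mul,
    SchwartzMap.fourierInv_coe]

variable {p : ℝ≥0∞} [hp : Fact (1 ≤ p)]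

theorem toTD_injective {g h : Lp ℂ p (volume : Measure V)}
    (H : (g : 𝓢'(V, ℂ)) = (h : 𝓢'(V, ℂ))) : g = h := by
  have hk := Lp.ker_toTemperedDistributionCLM_eq_bot (F := ℂ) (μ := (volume : Measure V)) (p := p)
  exact LinearMap.ker_eq_bot.1 hk H

/-- The target exponent `r` is independent of `p`, so that one identity serves both `L^p → L^p` and
`L^p → L^∞`. -/
theorem toTD_eq_fourierMultiplier {r : ℝ≥0∞} [Fact (1 ≤ r)] (M : 𝓢(V, ℂ))
    (f : Lp ℂ p (volume : Measure V)) {g : Lp ℂ r (volume : Measure V)}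
    (hg : g =ᵐ[volume] kconv (𝓕⁻ M : 𝓢(V, ℂ)) f) :
    (g : 𝓢'(V, ℂ)) = TemperedDistribution.fourierMultiplierCLM ℂ (M : V → ℂ) (f : 𝓢'(V, ℂ)) := by
  ext φ
  rw [TemperedDistribution.fourierMultiplierCLM_apply_apply, Lp.toTemperedDistribution_apply,
    Lp.toTemperedDistribution_apply]
  simp only [fourier_smulLeft_apply, smul_eq_mul]
  simp only [mul_comm _ (f _)]
  rw [← integral_kconv_fourierInv_mul hp.out M (Lp.memLp f) φ.integrable]
  refine integral_congr_ae ?_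
  filter_upwards [hg] with x hx
  rw [hx, mul_comm]

theorem memLp_kconv (M : 𝓢(V, ℂ)) (f : Lp ℂ p (volume : Measure V)) :
    MemLp (kconv (𝓕⁻ M : 𝓢(V, ℂ)) f) p volume := by
  refine ⟨aestronglyMeasurable_kconv (SchwartzMap.continuous _) (Lp.aestronglyMeasurable f), ?_⟩
  refine (eLpNorm_kconv_le (SchwartzMap.continuous _) (SchwartzMap.integrable _)
    (Lp.aestronglyMeasurable f) hp.out).trans_lt ?_
  exact ENNReal.mul_lt_top (SchwartzMap.eLpNorm_lt_top (𝓕⁻ M : 𝓢(V, ℂ)) 1 volume) (Lp.eLpNorm_lt_top f)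

theorem memLp_top_kconv (M : 𝓢(V, ℂ)) (f : Lp ℂ p (volume : Measure V)) :
    MemLp (kconv (𝓕⁻ M : 𝓢(V, ℂ)) f) ⊤ volume := by
  have := ENNReal.HolderConjugate.inv_one_sub_inv' hp.out
  refine ⟨aestronglyMeasurable_kconv (SchwartzMap.continuous _) (Lp.aestronglyMeasurable f), ?_⟩
  rw [eLpNorm_exponent_top]
  refine (eLpNormEssSup_le_of_ae_enorm_bound (Filter.Eventually.of_forall fun x =>
    enorm_kconv_le (SchwartzMap.continuous _) (Lp.aestronglyMeasurable f) p
      (1 - p⁻¹)⁻¹ x)).trans_lt ?_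
  exact ENNReal.mul_lt_top (SchwartzMap.eLpNorm_lt_top (𝓕⁻ M : 𝓢(V, ℂ)) _ volume) (Lp.eLpNorm_lt_top f)

/-- A linear map into `L^r` that represents a Fourier multiplier. -/
def multLinear {r : ℝ≥0∞} [Fact (1 ≤ r)] (M : 𝓢(V, ℂ))
    (h : ∀ f : Lp ℂ p (volume : Measure V), MemLp (kconv (𝓕⁻ M : 𝓢(V, ℂ)) f) r volume) :
    Lp ℂ p (volume : Measure V) →ₗ[ℂ] Lp ℂ r (volume : Measure V) where
  toFun f := (h f).toLp
  map_add' f g := by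
    -- Linearity is inherited from the multiplier on tempered distributions, where no
    -- almost-everywhere representatives intervene.
    apply toTD_injective
    have h1 := map_add (Lp.toTemperedDistributionCLM ℂ (volume : Measure V) r)
      (h f).toLp (h g).toLp
    have h2 := map_add (Lp.toTemperedDistributionCLM ℂ (volume : Measure V) p) f g
    simp only [Lp.toTemperedDistributionCLM_apply] at h1 h2
    rw [h1, toTD_eq_fourierMultiplier M _ (h f).coeFn_toLp,
      toTD_eq_fourierMultiplier M _ (h g).coeFn_toLp,
      toTD_eq_fourierMultiplier M _ (h (f + g)).coeFn_toLp, h2, map_add]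
  map_smul' c f := by
    apply toTD_injective
    have h1 := map_smul (Lp.toTemperedDistributionCLM ℂ (volume : Measure V) r)
      c (h f).toLp
    have h2 := map_smul (Lp.toTemperedDistributionCLM ℂ (volume : Measure V) p) c f
    simp only [Lp.toTemperedDistributionCLM_apply] at h1 h2
    rw [RingHom.id_apply, h1, toTD_eq_fourierMultiplier M _ (h f).coeFn_toLp,
      toTD_eq_fourierMultiplier M _ (h (c • f)).coeFn_toLp, h2, map_smul]

/-- The Fourier multiplier with Schwartz symbol `M` as an operator on `L^p`. -/
def multLp (M : 𝓢(V, ℂ)) :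
    Lp ℂ p (volume : Measure V) →L[ℂ] Lp ℂ p (volume : Measure V) :=
  (multLinear M (memLp_kconv M)).mkContinuous (eLpNorm (𝓕⁻ M : 𝓢(V, ℂ)) 1 volume).toReal
    fun f => by
      have hM := (SchwartzMap.eLpNorm_lt_top (𝓕⁻ M : 𝓢(V, ℂ)) 1 volume).ne
      rw [Lp.norm_def, Lp.norm_def, ← ENNReal.toReal_mul]
      refine ENNReal.toReal_mono (ENNReal.mul_ne_top hM (Lp.eLpNorm_ne_top f)) ?_
      rw [eLpNorm_congr_ae (show multLinear M (memLp_kconv M) f =ᵐ[volume] _ from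
        MemLp.coeFn_toLp (memLp_kconv M f))]
      exact eLpNorm_kconv_le (SchwartzMap.continuous _) (SchwartzMap.integrable _)
        (Lp.aestronglyMeasurable f) hp.out

theorem multLp_ae (M : 𝓢(V, ℂ)) (f : Lp ℂ p (volume : Measure V)) :
    multLp M f =ᵐ[volume] kconv (𝓕⁻ M : 𝓢(V, ℂ)) f :=
  (memLp_kconv M f).coeFn_toLp

theorem toTD_multLp (M : 𝓢(V, ℂ)) (f : Lp ℂ p (volume : Measure V)) :
    (multLp M f : 𝓢'(V, ℂ)) =
      TemperedDistribution.fourierMultiplierCLM ℂ (M : V → ℂ) (f : 𝓢'(V, ℂ)) :=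
  toTD_eq_fourierMultiplier M f (multLp_ae M f)

theorem enorm_multLp_le (M : 𝓢(V, ℂ)) (f : Lp ℂ p (volume : Measure V)) :
    ‖multLp M f‖ₑ ≤ eLpNorm (𝓕⁻ M : 𝓢(V, ℂ)) 1 volume * ‖f‖ₑ := by
  rw [Lp.enorm_def, Lp.enorm_def, eLpNorm_congr_ae (multLp_ae M f)]
  exact eLpNorm_kconv_le (SchwartzMap.continuous _) (SchwartzMap.integrable _)
    (Lp.aestronglyMeasurable f) hp.out

/-- The Fourier multiplier with Schwartz symbol `M` as a map from `L^p` to `L^∞`. -/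
def multTop (M : 𝓢(V, ℂ)) (f : Lp ℂ p (volume : Measure V)) : Lp ℂ ⊤ (volume : Measure V) :=
  (memLp_top_kconv M f).toLp

theorem multTop_ae (M : 𝓢(V, ℂ)) (f : Lp ℂ p (volume : Measure V)) :
    multTop M f =ᵐ[volume] kconv (𝓕⁻ M : 𝓢(V, ℂ)) f :=
  (memLp_top_kconv M f).coeFn_toLp

theorem toTD_multTop (M : 𝓢(V, ℂ)) (f : Lp ℂ p (volume : Measure V)) :
    (multTop M f : 𝓢'(V, ℂ)) =
      TemperedDistribution.fourierMultiplierCLM ℂ (M : V → ℂ) (f : 𝓢'(V, ℂ)) :=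
  toTD_eq_fourierMultiplier M f (multTop_ae M f)

/-- Bernstein's inequality `L^p → L^∞`. -/
theorem enorm_multTop_le (M : 𝓢(V, ℂ)) (f : Lp ℂ p (volume : Measure V)) :
    ‖multTop M f‖ₑ ≤ eLpNorm (𝓕⁻ M : 𝓢(V, ℂ)) (1 - p⁻¹)⁻¹ volume * ‖f‖ₑ := by
  have := ENNReal.HolderConjugate.inv_one_sub_inv' hp.out
  rw [Lp.enorm_def, Lp.enorm_def, eLpNorm_congr_ae (multTop_ae M f), eLpNorm_exponent_top]
  exact eLpNormEssSup_le_of_ae_enorm_bound (Filter.Eventually.of_forall fun x =>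
    enorm_kconv_le (SchwartzMap.continuous _) (Lp.aestronglyMeasurable f) p _ x)

theorem multLp_mul (M N : 𝓢(V, ℂ)) (f : Lp ℂ p (volume : Measure V)) {L : 𝓢(V, ℂ)}
    (h : ∀ ξ, M ξ * N ξ = L ξ) : multLp N (multLp M f) = multLp L f := by
  apply toTD_injective
  rw [toTD_multLp, toTD_multLp, toTD_multLp,
    TemperedDistribution.fourierMultiplierCLM_fourierMultiplierCLM_apply M.hasTemperateGrowth
      N.hasTemperateGrowth]
  congr 2
  ext ξ
  exact h ξ

theorem multTop_mul (M N : 𝓢(V, ℂ)) (f : Lp ℂ p (volume : Measure V)) {L : 𝓢(V, ℂ)}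
    (h : ∀ ξ, M ξ * N ξ = L ξ) : multTop N (multLp M f) = multTop L f := by
  apply toTD_injective
  rw [toTD_multTop, toTD_multLp, toTD_multTop,
    TemperedDistribution.fourierMultiplierCLM_fourierMultiplierCLM_apply M.hasTemperateGrowth
      N.hasTemperateGrowth]
  congr 2
  ext ξ
  exact h ξ

/-- A weak form of disjointness of spectra. It is applied twice below, once for each factor of a
product, and replaces the convolution of two distributional Fourier transforms. -/
theorem integral_kconv_mul_eq_zero (M : 𝓢(V, ℂ)) {f W : V → ℂ}
    (hf : MemLp f p volume) (hW : Integrable W) (h : ∀ ξ, M ξ ≠ 0 → 𝓕⁻ W ξ = 0) :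
    ∫ x, kconv (𝓕⁻ M : 𝓢(V, ℂ)) f x * W x = 0 := by
  rw [integral_kconv_fourierInv_mul hp.out M hf hW]
  have : (fun ξ => M ξ * 𝓕⁻ W ξ) = fun _ => 0 := by
    ext ξ
    by_cases hξ : M ξ = 0
    · simp [hξ]
    · simp [h ξ hξ]
  simp [this, Real.fourier_eq]

theorem fourierInv_char_smul (W : V → ℂ) (ξ η : V) :
    𝓕⁻ (fun x => ((𝐞 (inner ℝ x ξ) : Circle) : ℂ) * W x) η = 𝓕⁻ W (ξ + η) := by
  rw [Real.fourierInv_eq, Real.fourierInv_eq]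
  congr 1 with x
  rw [inner_add_right, AddChar.map_add_eq_mul, Circle.smul_def, Circle.smul_def, smul_eq_mul,
    smul_eq_mul]
  push_cast
  ring

/-- The spectrum of a product is contained in the sum of the spectra. -/
theorem multLp_mul_eq_zero {M₁ M₂ M₃ : 𝓢(V, ℂ)}
    (h : ∀ ξ η, M₁ ξ ≠ 0 → M₂ η ≠ 0 → M₃ (ξ + η) = 0) (f g : Lp ℂ p (volume : Measure V))
    {w : Lp ℂ p (volume : Measure V)}
    (hw : w =ᵐ[volume] fun x =>
      kconv (𝓕⁻ M₁ : 𝓢(V, ℂ)) f x * kconv (𝓕⁻ M₂ : 𝓢(V, ℂ)) g x) :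
    multLp M₃ w = 0 := by
  apply toTD_injective
  have h0 := map_zero (Lp.toTemperedDistributionCLM ℂ (volume : Measure V) p)
  rw [Lp.toTemperedDistributionCLM_apply] at h0
  rw [toTD_multLp, h0]
  ext φ
  rw [TemperedDistribution.fourierMultiplierCLM_apply_apply, Lp.toTemperedDistribution_apply]
  -- The pairing to be shown zero is `∫ w · 𝓕 N`, where `N` vanishes wherever `M₃` does.
  set N : 𝓢(V, ℂ) := SchwartzMap.smulLeftCLM ℂ (M₃ : V → ℂ) (𝓕⁻ φ) with hN
  have hN0 (ξ : V) (hξ : M₃ ξ = 0) : N ξ = 0 := by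
    rw [hN, SchwartzMap.smulLeftCLM_apply_apply M₃.hasTemperateGrowth, hξ, zero_smul]
  have hinv : 𝓕⁻ (𝓕 (N : V → ℂ)) = N := by
    rw [← SchwartzMap.fourier_coe, ← SchwartzMap.fourierInv_coe, fourierInv_fourier_eq]
  have hv : MemLp (kconv (𝓕⁻ M₂ : 𝓢(V, ℂ)) g) ⊤ volume := memLp_top_kconv M₂ g
  have hW : Integrable fun x => kconv (𝓕⁻ M₂ : 𝓢(V, ℂ)) g x * (𝓕 N : 𝓢(V, ℂ)) x :=
    (SchwartzMap.integrable (𝓕 N : 𝓢(V, ℂ))).mul_of_top_right hv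
  have key := integral_kconv_mul_eq_zero M₁ (Lp.memLp f) hW fun ξ hξ => by
    have hint : Integrable fun x => ((𝐞 (inner ℝ x ξ) : Circle) : ℂ) * (𝓕 N : 𝓢(V, ℂ)) x := by
      refine Integrable.bdd_mul (c := 1) (SchwartzMap.integrable (𝓕 N : 𝓢(V, ℂ))) ?_ ?_
      · refine Continuous.aestronglyMeasurable ?_
        have : Continuous fun z : V => inner ℝ z ξ := by fun_prop
        exact continuous_subtype_val.comp (continuous_fourierChar.comp this)
      · exact Filter.Eventually.of_forall fun z => (Circle.norm_coe _).le
    -- For fixed `ξ`, the inverse transform of the modulated `𝓕 N` at `η` is `N (ξ + η)`, which is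
    -- zero by `h` when `M₁ ξ` and `M₂ η` are nonzero.
    have h2 := integral_kconv_mul_eq_zero M₂ (Lp.memLp g) hint fun η hη => by
      rw [fourierInv_char_smul, SchwartzMap.fourier_coe, hinv]
      exact hN0 _ (h ξ η hξ hη)
    rw [Real.fourierInv_eq, ← h2]
    congr 1 with x
    rw [Circle.smul_def, smul_eq_mul]
    ring
  rw [show (0 : 𝓢'(V, ℂ)) φ = 0 from rfl, ← key]
  refine integral_congr_ae ?_
  filter_upwards [hw] with x hx
  rw [hx, smul_eq_mul]
  ring

theorem lpENorm_toTD {n : ℕ} (g : Lp ℂ p (volume : Measure (E n))) :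
    lpENorm p (g : 𝓢'(E n, ℂ)) = ‖g‖ₑ := by
  refine le_antisymm (iInf_le_of_le ⟨g, rfl⟩ le_rfl) (le_iInf fun a => ?_)
  rw [toTD_injective a.2]

end Multiplier



/-! ### Compactly supported functions are dense in the Schwartz space. -/

section Density

variable {V : Type*} [NormedAddCommGroup V] [InnerProductSpace ℝ V] [FiniteDimensional ℝ V]

/-- The error is `g (x / R) φ x` with `g = χ - 1` vanishing on the unit ball. It lives on `‖x‖ ≥ R`,
where one extra power of `‖x‖`, absorbed by the decay of `φ`, buys the factor `1 / R`. -/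
theorem seminorm_sub_cutoff_le (χ : ContDiffBump (0 : V)) (hχ : χ.rIn = 1) (φ : 𝓢(V, ℂ))
    (k l : ℕ) : ∃ C : ℝ, ∀ R : ℝ, 1 ≤ R → ∀ ψ : 𝓢(V, ℂ),
      (∀ x, ψ x = ((χ (R⁻¹ • x) : ℝ) : ℂ) * φ x) →
      SchwartzMap.seminorm ℝ k l (ψ - φ) ≤ C / R := by
  set g : V → ℝ := fun x => χ x - 1 with hg
  have hgs : ContDiff ℝ ∞ g := χ.contDiff.sub contDiff_const
  have hgt : g.HasTemperateGrowth :=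
    (χ.hasCompactSupport.hasTemperateGrowth χ.contDiff).sub (.const 1)
  obtain ⟨N, C, hC0, hC⟩ := hgt.norm_iteratedFDeriv_le_uniform l
  set D : ℝ := ∑ i ∈ Finset.range (l + 1), (l.choose i : ℝ) * (C *
    (2 ^ (k + N + 1) * (Finset.Iic (k + N + 1, l)).sup
      (fun m => SchwartzMap.seminorm ℝ m.1 m.2) φ)) with hD
  have hD0 : 0 ≤ D := Finset.sum_nonneg fun i _ => by positivity
  refine ⟨D, fun R hR ψ hψ => ?_⟩
  have hR0 : 0 < R := by linarith
  refine SchwartzMap.seminorm_le_bound ℝ k l _ (by positivity) fun x => ?_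
  have hfun : ((ψ - φ : 𝓢(V, ℂ)) : V → ℂ) = fun y => g (R⁻¹ • y) • φ y := by
    ext y
    rw [sub_apply, hψ, hg, Complex.real_smul]
    push_cast
    ring
  have hderiv (i : ℕ) (hi : i ≤ l) : ‖iteratedFDeriv ℝ i (fun y => g (R⁻¹ • y)) x‖ ≤
      C * (1 + ‖x‖) ^ (N + 1) / R := by
    rw [iteratedFDeriv_comp_const_smul _ (hgs.of_le (by exact_mod_cast le_top)), norm_smul]
    have h1 : ‖R⁻¹ ^ i‖ ≤ 1 := by
      rw [norm_pow, norm_inv, Real.norm_of_nonneg hR0.le]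
      exact pow_le_one₀ (by positivity) (inv_le_one_of_one_le₀ hR)
    rcases lt_or_ge ‖x‖ R with hx | hx
    · have hz : g =ᶠ[nhds (R⁻¹ • x)] fun _ => 0 := by
        have : R⁻¹ • x ∈ Metric.ball (0 : V) 1 := by
          rw [mem_ball_zero_iff, norm_smul, norm_inv, Real.norm_of_nonneg hR0.le, inv_mul_lt_iff₀ hR0]
          simpa using hx
        filter_upwards [Metric.isOpen_ball.mem_nhds this] with y hy
        rw [hg]
        simp only
        rw [χ.one_of_mem_closedBall (by rw [hχ]; exact Metric.ball_subset_closedBall hy), sub_self]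
      rw [hz.iteratedFDeriv ℝ i |>.eq_of_nhds]
      rw [show iteratedFDeriv ℝ i (fun _ : V => (0 : ℝ)) = 0 from iteratedFDeriv_fun_zero]
      simp only [Pi.zero_apply, norm_zero, mul_zero]
      positivity
    · have hxR : ‖R⁻¹ • x‖ ≤ ‖x‖ := by
        rw [norm_smul, norm_inv, Real.norm_of_nonneg hR0.le]
        exact mul_le_of_le_one_left (norm_nonneg _) (inv_le_one_of_one_le₀ hR)
      -- Here `(1 + ‖x‖) / R ≥ 1`, which accounts for the exponent `N + 1` and the denominator.
      calc ‖R⁻¹ ^ i‖ * ‖iteratedFDeriv ℝ i g (R⁻¹ • x)‖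
          ≤ 1 * (C * (1 + ‖x‖) ^ N) := by
            gcongr
            refine (hC i hi _).trans ?_
            gcongr
        _ ≤ C * (1 + ‖x‖) ^ (N + 1) / R := by
            rw [one_mul, le_div_iff₀ hR0, pow_succ, mul_assoc]
            gcongr
            linarith
  rw [hfun]
  have hgR : ContDiff ℝ ∞ fun y => g (R⁻¹ • y) := hgs.comp (contDiff_const_smul _)
  have hle := norm_iteratedFDeriv_smul_le hgR (φ.smooth ⊤) x (n := l) (by exact_mod_cast le_top)
  calc ‖x‖ ^ k * ‖iteratedFDeriv ℝ l (fun y => g (R⁻¹ • y) • φ y) x‖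
      ≤ (1 + ‖x‖) ^ k * ∑ i ∈ Finset.range (l + 1), (l.choose i : ℝ) *
          (C * (1 + ‖x‖) ^ (N + 1) / R) * ‖iteratedFDeriv ℝ (l - i) φ x‖ := by
        gcongr
        · linarith [norm_nonneg x]
        · refine hle.trans ?_
          gcongr with i hi
          exact hderiv i (by simp at hi; omega)
    _ = (∑ i ∈ Finset.range (l + 1), (l.choose i : ℝ) *
          (C * ((1 + ‖x‖) ^ (k + N + 1) * ‖iteratedFDeriv ℝ (l - i) φ x‖))) / R := by
        rw [Finset.mul_sum, Finset.sum_div]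
        refine Finset.sum_congr rfl fun i _ => ?_
        ring
    _ ≤ D / R := by
        rw [hD]
        refine div_le_div_of_nonneg_right (Finset.sum_le_sum fun i _ =>
          mul_le_mul_of_nonneg_left (mul_le_mul_of_nonneg_left ?_ hC0) (Nat.cast_nonneg _)) hR0.le
        exact SchwartzMap.one_add_le_sup_seminorm_apply (𝕜 := ℝ) (m := (k + N + 1, l)) le_rfl
          (Nat.sub_le _ _) φ x

/-- A tempered distribution that vanishes on compactly supported functions is zero. -/
theorem eq_zero_of_hasCompactSupport (T : 𝓢'(V, ℂ))
    (hT : ∀ φ : 𝓢(V, ℂ), HasCompactSupport φ → T φ = 0) : T = 0 := by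
  ext φ
  let χ : ContDiffBump (0 : V) := ⟨1, 2, one_pos, one_lt_two⟩
  have hc (m : ℕ) : HasCompactSupport fun x : V => ((χ (((m : ℝ) + 1)⁻¹ • x) : ℝ) : ℂ) := by
    have h1 : HasCompactSupport fun x : V => χ (((m : ℝ) + 1)⁻¹ • x) :=
      χ.hasCompactSupport.comp_smul (by positivity)
    exact h1.comp_left (g := fun t : ℝ => (t : ℂ)) Complex.ofReal_zero
  have hs (m : ℕ) : ContDiff ℝ ∞ fun x : V => ((χ (((m : ℝ) + 1)⁻¹ • x) : ℝ) : ℂ) :=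
    Complex.ofRealCLM.contDiff.comp (χ.contDiff.comp (contDiff_const_smul _))
  let ψ (m : ℕ) : 𝓢(V, ℂ) :=
    SchwartzMap.smulLeftCLM ℂ (fun x : V => ((χ (((m : ℝ) + 1)⁻¹ • x) : ℝ) : ℂ)) φ
  have hψ (m : ℕ) (x : V) : ψ m x = ((χ (((m : ℝ) + 1)⁻¹ • x) : ℝ) : ℂ) * φ x := by
    simp only [ψ]
    rw [SchwartzMap.smulLeftCLM_apply_apply ((hc m).hasTemperateGrowth (hs m)), smul_eq_mul]
  have hlim : Filter.Tendsto ψ Filter.atTop (nhds φ) := by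
    rw [(schwartz_withSeminorms ℝ V ℂ).tendsto_nhds]
    rintro ⟨k, l⟩ ε hε
    obtain ⟨C, hC⟩ := seminorm_sub_cutoff_le χ rfl φ k l
    have h0 : Filter.Tendsto (fun m : ℕ => C / ((m : ℝ) + 1)) Filter.atTop (nhds 0) :=
      tendsto_const_nhds.div_atTop
        (Filter.tendsto_atTop_add_const_right _ _ tendsto_natCast_atTop_atTop)
    filter_upwards [h0.eventually (gt_mem_nhds hε)] with m hm
    exact (hC _ (by linarith [(Nat.cast_nonneg m : (0 : ℝ) ≤ m)]) (ψ m) (hψ m)).trans_lt hm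
  have hz (m : ℕ) : T (ψ m) = 0 := by
    refine hT _ ?_
    have : (ψ m : V → ℂ) = fun x => ((χ (((m : ℝ) + 1)⁻¹ • x) : ℝ) : ℂ) * φ x := funext (hψ m)
    rw [this]
    exact (hc m).mul_right
  have h2 := ((map_continuous T).tendsto φ).comp hlim
  simp only [Function.comp_def, hz] at h2
  exact tendsto_nhds_unique h2 tendsto_const_nhds

end Density



/-! ### The partition of unity, its symbols, and injectivity of the decomposition. -/

section Window

variable {n : ℕ}

@[simp]
theorem latticePt_apply (k : Fin n → ℤ) (i : Fin n) : latticePt k i = k i := rfl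

theorem latticePt_add (k l : Fin n → ℤ) : latticePt (k + l) = latticePt k + latticePt l := by
  ext i; simp

@[simp]
theorem latticePt_zero : latticePt (0 : Fin n → ℤ) = 0 := by
  ext i; simp

/-- The lattice points in the cube of side length `2N`. -/
def cube (n N : ℕ) : Finset (Fin n → ℤ) := Fintype.piFinset fun _ => Finset.Icc (-(N : ℤ)) N

theorem mem_cube {N : ℕ} {k : Fin n → ℤ} : k ∈ cube n N ↔ ∀ i, |k i| ≤ N := by
  simp [cube, abs_le]

theorem abs_apply_le_norm (x : E n) (i : Fin n) : |x i| ≤ ‖x‖ := by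
  simpa using PiLp.norm_apply_le x i

variable {ρ : E n → ℝ}

theorem IsWindow.abs_le_one (hρ : IsWindow ρ) {ξ : E n} (h : ρ ξ ≠ 0) (i : Fin n) : |ξ i| ≤ 1 :=
  hρ.tsupport_subset (subset_tsupport _ h) i

/-- Local finiteness: on a ball, only the translates with index in a fixed cube are nonzero. -/
theorem IsWindow.mem_cube (hρ : IsWindow ρ) {ξ : E n} {N : ℕ} (hξ : ‖ξ‖ ≤ N) {j : Fin n → ℤ}
    (h : ρ (ξ - latticePt j) ≠ 0) : j ∈ cube n (N + 1) := by
  rw [GevreyModulation.mem_cube]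
  intro i
  have h1 := hρ.abs_le_one h i
  have h2 := (abs_apply_le_norm ξ i).trans hξ
  simp only [PiLp.sub_apply, latticePt_apply] at h1
  have : |((j i : ℤ) : ℝ)| ≤ ((N + 1 : ℕ) : ℝ) := by
    rw [abs_le] at *
    push_cast
    constructor <;> linarith
  exact_mod_cast this

/-- The sum of the translates of the window. -/
def windowSum (ρ : E n → ℝ) (ξ : E n) : ℝ := ∑' j : Fin n → ℤ, ρ (ξ - latticePt j)

theorem IsWindow.windowSum_eq (hρ : IsWindow ρ) {ξ : E n} {N : ℕ} (hξ : ‖ξ‖ ≤ N) :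
    windowSum ρ ξ = ∑ j ∈ cube n (N + 1), ρ (ξ - latticePt j) :=
  tsum_eq_sum fun j hj => by
    by_contra h
    exact hj (hρ.mem_cube hξ h)

theorem IsWindow.contDiff_windowSum (hρ : IsWindow ρ) : ContDiff ℝ ∞ (windowSum ρ) := by
  rw [contDiff_iff_contDiffAt]
  intro ξ
  obtain ⟨N, hN⟩ := exists_nat_gt ‖ξ‖
  have h1 : ContDiff ℝ ∞ fun ξ => ∑ j ∈ cube n (N + 1), ρ (ξ - latticePt j) :=
    ContDiff.sum fun j _ => hρ.contDiff.comp (contDiff_id.sub contDiff_const)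
  refine h1.contDiffAt.congr_of_eventuallyEq ?_
  filter_upwards [continuous_norm.continuousAt.eventually (gt_mem_nhds hN)] with η hη
  exact hρ.windowSum_eq (le_of_lt hη)

/-- Rounding the coordinates of `ξ` gives a lattice point within `1/2` in each coordinate, whose
translate of `ρ` equals one at `ξ`. -/
theorem IsWindow.windowSum_pos (hρ : IsWindow ρ) (ξ : E n) : 0 < windowSum ρ ξ := by
  obtain ⟨N, hN⟩ := exists_nat_gt ‖ξ‖
  rw [hρ.windowSum_eq hN.le]
  have h1 : ρ (ξ - latticePt fun i => round (ξ i)) = 1 :=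
    hρ.eq_one _ fun i => by simpa using abs_sub_round (ξ i)
  have hmem := hρ.mem_cube hN.le (by rw [h1]; exact one_ne_zero)
  refine (one_pos.trans_eq h1.symm).trans_le ?_
  exact Finset.single_le_sum (f := fun j => ρ (ξ - latticePt j)) (fun j _ => hρ.nonneg _) hmem

theorem windowSum_sub (ρ : E n → ℝ) (ξ : E n) (k : Fin n → ℤ) :
    windowSum ρ (ξ - latticePt k) = windowSum ρ ξ := by
  unfold windowSum
  rw [← (Equiv.addRight k).tsum_eq fun j => ρ (ξ - latticePt j)]
  refine tsum_congr fun j => ?_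
  rw [Equiv.coe_addRight, latticePt_add, sub_sub, add_comm]

theorem sigma_eq_div (ρ : E n → ℝ) (k : Fin n → ℤ) (ξ : E n) :
    sigma ρ k ξ = ρ (ξ - latticePt k) / windowSum ρ ξ := rfl

/-- The denominator is `ℤⁿ`-periodic, so all the `σ_k` are translates of `σ_0`; this is the source
of uniformity in `k`. -/
theorem sigma_eq_sub (ρ : E n → ℝ) (k : Fin n → ℤ) (ξ : E n) :
    sigma ρ k ξ = sigma ρ 0 (ξ - latticePt k) := by
  rw [sigma_eq_div, sigma_eq_div, windowSum_sub, latticePt_zero, sub_zero]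

theorem IsWindow.contDiff_sigma (hρ : IsWindow ρ) : ContDiff ℝ ∞ (sigma ρ 0) := by
  have h1 : ContDiff ℝ ∞ fun ξ => ρ (ξ - latticePt 0) :=
    hρ.contDiff.comp (contDiff_id.sub contDiff_const)
  exact h1.div hρ.contDiff_windowSum fun ξ => (hρ.windowSum_pos ξ).ne'

theorem IsWindow.abs_le_one_of_sigma (hρ : IsWindow ρ) {ξ : E n} (h : sigma ρ 0 ξ ≠ 0)
    (i : Fin n) : |ξ i| ≤ 1 := by
  refine hρ.abs_le_one (ξ := ξ) (fun h0 => h ?_) i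
  rw [sigma_eq_div, latticePt_zero, sub_zero, h0, zero_div]

theorem norm_le_sqrt_of_abs_le_one {ξ : E n} (h : ∀ i, |ξ i| ≤ 1) : ‖ξ‖ ≤ √n := by
  rw [EuclideanSpace.norm_eq]
  refine Real.sqrt_le_sqrt ?_
  refine (Finset.sum_le_card_nsmul _ _ 1 fun i _ => ?_).trans (by simp)
  rw [Real.norm_eq_abs]
  exact pow_le_one₀ (abs_nonneg _) (h i)

theorem IsWindow.hasCompactSupport_sigma (hρ : IsWindow ρ) : HasCompactSupport (sigma ρ 0) := by
  refine HasCompactSupport.of_support_subset_isCompact (isCompact_closedBall (0 : E n) (√n)) ?_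
  intro ξ hξ
  rw [mem_closedBall_zero_iff]
  exact norm_le_sqrt_of_abs_le_one (hρ.abs_le_one_of_sigma hξ)

theorem IsWindow.sum_sigma (hρ : IsWindow ρ) {ξ : E n} {N : ℕ} (hξ : ‖ξ‖ ≤ N) :
    ∑ k ∈ cube n (N + 1), sigma ρ k ξ = 1 := by
  simp only [sigma_eq_div, ← Finset.sum_div]
  rw [← hρ.windowSum_eq hξ, div_self (hρ.windowSum_pos ξ).ne']

/-- The Schwartz function `ζ ↦ a(2πζ - k)` for a smooth compactly supported `a`. -/
def symbol (a : E n → ℝ) (hc : HasCompactSupport a) (hs : ContDiff ℝ ∞ a) (k : Fin n → ℤ) :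
    𝓢(E n, ℂ) :=
  HasCompactSupport.toSchwartzMap
    (f := fun ζ : E n => ((a ((2 * Real.pi) • ζ - latticePt k) : ℝ) : ℂ))
    (by
      have h1 : HasCompactSupport fun ξ : E n => a (ξ - latticePt k) :=
        hc.comp_homeomorph (Homeomorph.subRight (latticePt k))
      have h2 := h1.comp_smul (c := 2 * Real.pi) (by positivity)
      exact h2.comp_left (g := fun t : ℝ => (t : ℂ)) Complex.ofReal_zero)
    (Complex.ofRealCLM.contDiff.comp
      (hs.comp ((contDiff_const_smul (2 * Real.pi)).sub contDiff_const)))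

@[simp]
theorem symbol_apply (a : E n → ℝ) (hc : HasCompactSupport a) (hs : ContDiff ℝ ∞ a)
    (k : Fin n → ℤ) (ζ : E n) :
    symbol a hc hs k ζ = ((a ((2 * Real.pi) • ζ - latticePt k) : ℝ) : ℂ) := rfl

-- Translating the symbol multiplies its inverse transform by a character. The kernels for different
-- `k` thus have the same `L^r` norms.
open FourierTransform in
theorem norm_fourierInv_symbol (a : E n → ℝ) (hc : HasCompactSupport a) (hs : ContDiff ℝ ∞ a)
    (k : Fin n → ℤ) (x : E n) :
    ‖(𝓕⁻ (symbol a hc hs k) : 𝓢(E n, ℂ)) x‖ = ‖(𝓕⁻ (symbol a hc hs 0) : 𝓢(E n, ℂ)) x‖ := by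
  rw [SchwartzMap.fourierInv_coe, SchwartzMap.fourierInv_coe, Real.fourierInv_eq,
    Real.fourierInv_eq, ← integral_add_right_eq_self _ ((2 * Real.pi)⁻¹ • latticePt k)]
  have (v : E n) : Real.fourierChar (inner ℝ (v + (2 * Real.pi)⁻¹ • latticePt k) x) •
        symbol a hc hs k (v + (2 * Real.pi)⁻¹ • latticePt k) =
      ((Real.fourierChar (inner ℝ ((2 * Real.pi)⁻¹ • latticePt k) x) : Circle) : ℂ) *
        (Real.fourierChar (inner ℝ v x) • symbol a hc hs 0 v) := by
    rw [inner_add_left, AddChar.map_add_eq_mul, Circle.smul_def, Circle.smul_def, smul_eq_mul,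
      smul_eq_mul, symbol_apply, symbol_apply, smul_add, smul_smul,
      mul_inv_cancel₀ (by positivity), one_smul, add_sub_cancel_right, latticePt_zero, sub_zero]
    push_cast
    ring
  simp only [this]
  rw [integral_const_mul, norm_mul, Circle.norm_coe, one_mul]

open FourierTransform in
theorem eLpNorm_fourierInv_symbol (a : E n → ℝ) (hc : HasCompactSupport a) (hs : ContDiff ℝ ∞ a)
    (k : Fin n → ℤ) (r : ℝ≥0∞) :
    eLpNorm (𝓕⁻ (symbol a hc hs k) : 𝓢(E n, ℂ)) r volume =
      eLpNorm (𝓕⁻ (symbol a hc hs 0) : 𝓢(E n, ℂ)) r volume :=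
  eLpNorm_congr_norm_ae (Filter.Eventually.of_forall fun x => norm_fourierInv_symbol a hc hs k x)

/-- The symbol of the operator `□_k` for Mathlib's normalization of the Fourier transform. -/
def boxSymbol (hρ : IsWindow ρ) (k : Fin n → ℤ) : 𝓢(E n, ℂ) :=
  symbol (sigma ρ 0) hρ.hasCompactSupport_sigma hρ.contDiff_sigma k

theorem boxSymbol_apply (hρ : IsWindow ρ) (k : Fin n → ℤ) (ζ : E n) :
    boxSymbol hρ k ζ = ((sigma ρ k ((2 * Real.pi) • ζ) : ℝ) : ℂ) := by
  rw [sigma_eq_sub]; rfl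

theorem box_eq (hρ : IsWindow ρ) (k : Fin n → ℤ) :
    box ρ k = TemperedDistribution.fourierMultiplierCLM ℂ (boxSymbol hρ k : E n → ℂ) := by
  unfold box
  congr 1
  ext ζ
  rw [boxSymbol_apply]

theorem abs_sub_le_one_of_boxSymbol (hρ : IsWindow ρ) {k : Fin n → ℤ} {ζ : E n}
    (h : boxSymbol hρ k ζ ≠ 0) (i : Fin n) : |2 * Real.pi * ζ i - k i| ≤ 1 := by
  have h1 : sigma ρ 0 ((2 * Real.pi) • ζ - latticePt k) ≠ 0 := fun h0 => h (by
    rw [boxSymbol, symbol_apply, h0, Complex.ofReal_zero])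
  simpa using hρ.abs_le_one_of_sigma h1 i

/-- Each of the three frequencies is within `1` of its lattice point in every coordinate, hence the
`3`. -/
theorem boxSymbol_add_eq_zero (hρ : IsWindow ρ) {k l m : Fin n → ℤ}
    (hm : m - k - l ∉ cube n 3) (ξ η : E n) (hξ : boxSymbol hρ k ξ ≠ 0)
    (hη : boxSymbol hρ l η ≠ 0) : boxSymbol hρ m (ξ + η) = 0 := by
  by_contra h
  refine hm (mem_cube.2 fun i => ?_)
  have h1 := abs_sub_le_one_of_boxSymbol hρ hξ i
  have h2 := abs_sub_le_one_of_boxSymbol hρ hη i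
  have h3 := abs_sub_le_one_of_boxSymbol hρ h i
  have : |((m i - k i - l i : ℤ) : ℝ)| ≤ ((3 : ℕ) : ℝ) := by
    simp only [PiLp.add_apply] at h3
    push_cast
    rw [abs_le] at *
    constructor <;> linarith
  exact_mod_cast this

/-- A bump function that is equal to one on the support of the window. -/
def fatBump (n : ℕ) : ContDiffBump (0 : E n) := ⟨√n + 1, √n + 2, by positivity, by linarith⟩

/-- A symbol that is equal to one on the support of `boxSymbol`. -/
def fatSymbol (k : Fin n → ℤ) : 𝓢(E n, ℂ) :=
  symbol (fatBump n) (fatBump n).hasCompactSupport (fatBump n).contDiff k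

/-- The cube `|ξᵢ| ≤ 1` lies in the ball of radius `√n`, on which the bump is one; the extra `1` in
its inner radius keeps that radius positive when `n = 0`. -/
theorem boxSymbol_mul_fatSymbol (hρ : IsWindow ρ) (k : Fin n → ℤ) (ζ : E n) :
    boxSymbol hρ k ζ * fatSymbol k ζ = boxSymbol hρ k ζ := by
  by_cases h : sigma ρ 0 ((2 * Real.pi) • ζ - latticePt k) = 0
  · simp [boxSymbol, h]
  · rw [fatSymbol, symbol_apply, ContDiffBump.one_of_mem_closedBall]
    · simp
    · rw [mem_closedBall_zero_iff]
      exact (norm_le_sqrt_of_abs_le_one (hρ.abs_le_one_of_sigma h)).trans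
        (by simp [fatBump])

open FourierTransform in
/-- The decomposition `f ↦ (□_k f)_k` is injective. -/
theorem eq_zero_of_box_eq_zero (hρ : IsWindow ρ) {p : ℝ≥0∞} [Fact (1 ≤ p)]
    {h : Lp ℂ p (volume : Measure (E n))} (hk : ∀ k, box ρ k (h : 𝓢'(E n, ℂ)) = 0) : h = 0 := by
  apply toTD_injective
  rw [toTD_zero]
  have hT : 𝓕 (h : 𝓢'(E n, ℂ)) = 0 := by
    refine eq_zero_of_hasCompactSupport _ fun φ hφ => ?_
    obtain ⟨R, hR⟩ := (hφ.isCompact.isBounded).subset_closedBall 0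
    obtain ⟨N, hN⟩ := exists_nat_ge (2 * Real.pi * R)
    -- On the support of `φ` finitely many `σ_k` already add up to one, so the pairing of `𝓕 h` with
    -- `φ` is a finite sum of pairings of the `□_k h`.
    have hsum : φ = ∑ k ∈ cube n (N + 1),
        SchwartzMap.smulLeftCLM ℂ (boxSymbol hρ k : E n → ℂ) φ := by
      ext ζ
      rw [sum_apply]
      simp only [SchwartzMap.smulLeftCLM_apply_apply (boxSymbol hρ _).hasTemperateGrowth,
        smul_eq_mul]
      rw [← Finset.sum_mul]
      by_cases hζ : φ ζ = 0
      · simp [hζ]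
      have h1 : ‖(2 * Real.pi) • ζ‖ ≤ N := by
        have : ‖ζ‖ ≤ R := by simpa using hR (subset_tsupport _ hζ)
        rw [norm_smul, Real.norm_of_nonneg (by positivity)]
        exact le_trans (by gcongr) hN
      simp only [boxSymbol_apply]
      rw [← Complex.ofReal_sum, hρ.sum_sigma h1]
      simp
    rw [hsum, map_sum]
    refine Finset.sum_eq_zero fun k _ => ?_
    have := congrArg (fun T : 𝓢'(E n, ℂ) => T (𝓕 φ)) (hk k)
    rw [box_eq hρ] at this
    simpa using this
  have hinv : 𝓕⁻ (𝓕 (h : 𝓢'(E n, ℂ)) : 𝓢'(E n, ℂ)) = (h : 𝓢'(E n, ℂ)) :=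
    fourierInv_fourier_eq _
  rw [← hinv, hT]
  exact (fourierInvCLM ℂ 𝓢'(E n, ℂ)).map_zero

end Window



/-! ### The Gevrey weight and the discrete convolution estimate. -/

section Weight

variable {n : ℕ}

/-- The points `a` and `2b` lie between `b` and `a + b` and have the same sum, so concavity gives
`b^t + (a+b)^t ≤ a^t + (2b)^t`. The two uses of concavity have the weights `b/a` and `(a-b)/a`
interchanged. -/
theorem add_rpow_le {t : ℝ} (ht0 : 0 ≤ t) (ht1 : t ≤ 1) {a b : ℝ} (hb : 0 ≤ b) (hab : b ≤ a) :
    (a + b) ^ t ≤ a ^ t + b ^ t - (2 - 2 ^ t) * b ^ t := by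
  rcases hb.eq_or_lt with rfl | hb0
  · rw [add_zero]
    have h1 : 0 ≤ (0 : ℝ) ^ t := Real.rpow_nonneg le_rfl t
    rcases ht0.eq_or_lt with rfl | ht
    · norm_num
    · simp [Real.zero_rpow ht.ne']
  have ha0 : 0 < a := hb0.trans_le hab
  have hconc := Real.concaveOn_rpow ht0 ht1
  have h1 := hconc.2 (show b ∈ Set.Ici 0 from hb)
    (show a + b ∈ Set.Ici 0 from Set.mem_Ici.2 (by positivity))
    (show 0 ≤ b / a by positivity) (show 0 ≤ (a - b) / a from div_nonneg (by linarith) ha0.le)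
    (by field_simp; ring)
  have h2 := hconc.2 (show b ∈ Set.Ici 0 from hb)
    (show a + b ∈ Set.Ici 0 from Set.mem_Ici.2 (by positivity))
    (show 0 ≤ (a - b) / a from div_nonneg (by linarith) ha0.le) (show 0 ≤ b / a by positivity)
    (by field_simp; ring)
  simp only [smul_eq_mul] at h1 h2
  have e1 : b / a * b + (a - b) / a * (a + b) = a := by field_simp; ring
  have e2 : (a - b) / a * b + b / a * (a + b) = 2 * b := by field_simp; ring
  rw [e1] at h1
  rw [e2, Real.mul_rpow zero_le_two hb] at h2
  have e3 : b / a + (a - b) / a = 1 := by field_simp; ring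
  have : b ^ t + (a + b) ^ t ≤ a ^ t + 2 ^ t * b ^ t := by
    calc b ^ t + (a + b) ^ t = (b / a + (a - b) / a) * (b ^ t + (a + b) ^ t) := by rw [e3, one_mul]
      _ ≤ a ^ t + 2 ^ t * b ^ t := by linarith
  linarith

/-- The decay that the Gevrey weight gains over submultiplicativity. -/
def gain (s : ℝ) (k : Fin n → ℤ) : ℝ :=
  Real.exp (-((2 - 2 ^ (1 / s)) * ‖latticePt k‖ ^ (1 / s)))

theorem gain_pos (s : ℝ) (k : Fin n → ℤ) : 0 < gain s k := Real.exp_pos _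

/-- The offset `r` will range over a finite set, so plain subadditivity suffices for it. The gain
belongs to the smaller of `k` and `l`; the sum of both gains dominates it and is symmetric. -/
theorem exp_weight_le {s : ℝ} (hs : 1 < s) (r k l m : Fin n → ℤ) (hm : m = r + k + l) :
    Real.exp (‖latticePt m‖ ^ (1 / s)) ≤ Real.exp (‖latticePt r‖ ^ (1 / s)) *
      (Real.exp (‖latticePt k‖ ^ (1 / s)) * Real.exp (‖latticePt l‖ ^ (1 / s)) *
        (gain s k + gain s l)) := by
  have ht0 : 0 ≤ 1 / s := by positivity
  have ht1 : 1 / s ≤ 1 := by rw [div_le_one (by linarith)]; exact hs.le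
  set t := 1 / s
  have h1 : ‖latticePt m‖ ^ t ≤ ‖latticePt r‖ ^ t + (‖latticePt k‖ + ‖latticePt l‖) ^ t := by
    refine le_trans ?_ (Real.rpow_add_le_add_rpow (norm_nonneg _) (by positivity) ht0 ht1)
    refine Real.rpow_le_rpow (norm_nonneg _) ?_ ht0
    rw [hm, latticePt_add, latticePt_add, add_assoc]
    exact (norm_add_le _ _).trans (by gcongr; exact norm_add_le _ _)
  have key (a b : Fin n → ℤ) (hab : ‖latticePt b‖ ≤ ‖latticePt a‖) :
      Real.exp ((‖latticePt a‖ + ‖latticePt b‖) ^ t) ≤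
        Real.exp (‖latticePt a‖ ^ t) * Real.exp (‖latticePt b‖ ^ t) * gain s b := by
    rw [gain, ← Real.exp_add, ← Real.exp_add]
    refine Real.exp_le_exp.2 ?_
    have := add_rpow_le ht0 ht1 (norm_nonneg _) hab
    linarith
  refine (Real.exp_le_exp.2 h1).trans ?_
  rw [Real.exp_add]
  gcongr
  have g1 := gain_pos s k
  have g2 := gain_pos s l
  rcases le_total ‖latticePt l‖ ‖latticePt k‖ with h | h
  · refine (key k l h).trans ?_
    gcongr
    linarith
  · rw [add_comm]
    refine (key l k h).trans ?_
    rw [mul_comm (Real.exp (‖latticePt l‖ ^ t))]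
    gcongr
    linarith

/-- `gain` as an extended nonnegative function. -/
def egain (s : ℝ) (k : Fin n → ℤ) : ℝ≥0∞ := ENNReal.ofReal (gain s k)

theorem weight_eq (s : ℝ) (k : Fin n → ℤ) :
    (weight s k : ℝ≥0∞) = ENNReal.ofReal (Real.exp (‖latticePt k‖ ^ (1 / s))) := rfl

theorem weight_le {s : ℝ} (hs : 1 < s) (r k l m : Fin n → ℤ) (hm : m = r + k + l) :
    (weight s m : ℝ≥0∞) ≤ weight s r * (weight s k * weight s l * (egain s k + egain s l)) := by
  simp only [weight_eq, egain]
  rw [← ENNReal.ofReal_add (gain_pos s k).le (gain_pos s l).le,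
    ← ENNReal.ofReal_mul (Real.exp_pos _).le, ← ENNReal.ofReal_mul (by positivity),
    ← ENNReal.ofReal_mul (Real.exp_pos _).le]
  exact ENNReal.ofReal_le_ofReal (exp_weight_le hs r k l m hm)

theorem latticePt_injective : Function.Injective (latticePt : (Fin n → ℤ) → E n) := by
  intro k l hkl
  ext i
  have h : ((k i : ℤ) : ℝ) = l i := congrArg (fun x : E n => x i) hkl
  exact_mod_cast h

theorem latticePt_mem_span (k : Fin n → ℤ) : latticePt k ∈
    Submodule.span ℤ (Set.range (EuclideanSpace.basisFun (Fin n) ℝ).toBasis) := by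
  have : latticePt k = ∑ i, k i • (EuclideanSpace.basisFun (Fin n) ℝ).toBasis i := by
    ext j
    simp [Pi.single_apply]
  rw [this]
  exact Submodule.sum_mem _ fun i _ => Submodule.smul_mem _ _ (Submodule.subset_span ⟨i, rfl⟩)

theorem summable_comp_latticePt {L : Submodule ℤ (E n)} (hL : ∀ k : Fin n → ℤ, latticePt k ∈ L)
    {F : E n → ℝ} (h : Summable fun z : L => F z) :
    Summable fun k : Fin n → ℤ => F (latticePt k) :=
  h.comp_injective (i := fun k => (⟨latticePt k, hL k⟩ : L)) fun _ _ hkl =>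
    latticePt_injective (congrArg Subtype.val hkl)

theorem summable_pow_span (n : ℕ) : Summable fun z :
    Submodule.span ℤ (Set.range (EuclideanSpace.basisFun (Fin n) ℝ).toBasis) =>
      ‖z‖ ^ (-((n : ℝ) + 1)) := by
  refine ZLattice.summable_norm_rpow _ (-((n : ℝ) + 1)) ?_
  rw [ZLattice.rank ℝ]
  simp

theorem summable_pow_latticePt (n : ℕ) :
    Summable fun k : Fin n → ℤ => ‖latticePt k‖ ^ (-((n : ℝ) + 1)) :=
  summable_comp_latticePt (F := fun x => ‖x‖ ^ (-((n : ℝ) + 1))) latticePt_mem_span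
    (summable_pow_span n)

/-- Comparison with `‖k‖^{-(n+1)}` through `e^y ≥ y^M / M!` with `M t > n + 1`. The comparison is
only made for `‖k‖ ≥ 1`; at `k = 0` the majorant takes the default value `0`. -/
theorem summable_exp_neg_rpow (n : ℕ) {c t : ℝ} (hc : 0 < c) (ht : 0 < t) :
    Summable fun k : Fin n → ℤ => Real.exp (-(c * ‖latticePt k‖ ^ t)) := by
  obtain ⟨M, hM⟩ := exists_nat_gt (((n : ℝ) + 1) / t)
  refine Summable.of_norm_bounded_eventually
    ((summable_pow_latticePt n).mul_left (M.factorial * (c⁻¹) ^ M)) ?_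
  have hfin : {k : Fin n → ℤ | ¬ 1 ≤ ‖latticePt k‖} ⊆ {0} := by
    intro k hk
    simp only [Set.mem_ofPred_eq, not_le] at hk
    ext i
    have h1 : |((k i : ℤ) : ℝ)| < 1 := (abs_apply_le_norm (latticePt k) i).trans_lt hk
    have h2 : |k i| < 1 := by exact_mod_cast h1
    simpa using Int.abs_lt_one_iff.1 h2
  have hev : ∀ᶠ k : Fin n → ℤ in Filter.cofinite, 1 ≤ ‖latticePt k‖ :=
    (Set.finite_singleton _).subset hfin
  filter_upwards [hev] with k hk
  have hk0 : 0 < ‖latticePt k‖ := by linarith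
  set x := ‖latticePt k‖
  have hx : 0 < c * x ^ t := by positivity
  rw [Real.norm_of_nonneg (Real.exp_pos _).le, Real.exp_neg]
  have h1 := Real.pow_div_factorial_le_exp (c * x ^ t) hx.le M
  have h2 : x ^ ((n : ℝ) + 1) ≤ (x ^ t) ^ M := by
    rw [← Real.rpow_natCast, ← Real.rpow_mul hk0.le]
    refine Real.rpow_le_rpow_of_exponent_le hk ?_
    rw [div_lt_iff₀ ht] at hM
    linarith
  rw [Real.rpow_neg hk0.le]
  calc (Real.exp (c * x ^ t))⁻¹ ≤ ((c * x ^ t) ^ M / M.factorial)⁻¹ := by gcongr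
    _ = M.factorial * c⁻¹ ^ M * ((x ^ t) ^ M)⁻¹ := by
        rw [mul_pow, inv_pow]
        field_simp
    _ ≤ _ := by gcongr

theorem tsum_egain_lt_top {s : ℝ} (hs : 1 < s) : ∑' k : Fin n → ℤ, egain s k < ⊤ := by
  have ht : (0 : ℝ) < 1 / s := by positivity
  have h1 : 1 / s < 1 := by rw [div_lt_one (by linarith)]; exact hs
  have h2 : (2 : ℝ) ^ (1 / s) < 2 := by
    simpa using Real.rpow_lt_rpow_of_exponent_lt one_lt_two h1
  exact ((summable_exp_neg_rpow n (sub_pos.2 h2) ht).tsum_ofReal_lt_top)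

theorem tsum_inv_weight_lt_top {s : ℝ} (hs : 1 < s) :
    ∑' k : Fin n → ℤ, (weight s k : ℝ≥0∞)⁻¹ < ⊤ := by
  have ht : (0 : ℝ) < 1 / s := by positivity
  have h := ((summable_exp_neg_rpow n one_pos ht).tsum_ofReal_lt_top)
  refine lt_of_eq_of_lt (tsum_congr fun k => ?_) h
  rw [weight_eq, ← ENNReal.ofReal_inv_of_pos (Real.exp_pos _), ← Real.exp_neg, one_mul]

theorem weight_ne_zero (s : ℝ) (k : Fin n → ℤ) : (weight s k : ℝ≥0∞) ≠ 0 := by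
  rw [weight_eq]
  simpa using Real.exp_pos _

/-- Each weighted term is at most the `ℓ^q` norm, and the inverse weights are summable; no conjugate
exponent is needed. -/
theorem tsum_le_eLpNorm_weight {s : ℝ} {q : ℝ≥0∞} (hq : 1 ≤ q)
    (a : (Fin n → ℤ) → ℝ≥0∞) :
    ∑' k, a k ≤ (∑' k : Fin n → ℤ, (weight s k : ℝ≥0∞)⁻¹) *
      eLpNorm (fun k => (weight s k : ℝ≥0∞) * a k) q Measure.count := by
  rw [← ENNReal.tsum_mul_right]
  refine ENNReal.tsum_le_tsum fun k => ?_
  have h := enorm_le_eLpNorm_count (fun k => (weight s k : ℝ≥0∞) * a k) k (one_pos.trans_le hq).ne'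
  rw [enorm_eq_self] at h
  calc a k = (weight s k : ℝ≥0∞)⁻¹ * (weight s k * a k) := by
        rw [← mul_assoc, ENNReal.inv_mul_cancel (weight_ne_zero s k) ENNReal.coe_ne_top, one_mul]
    _ ≤ _ := by gcongr

theorem eLpNorm_count_conv_le {q : ℝ≥0∞} (hq : 1 ≤ q) (a b : (Fin n → ℤ) → ℝ≥0∞)
    (ha : ∑' k, a k ≠ ⊤) :
    eLpNorm (fun m => ∑' k, a (m - k) * b k) q Measure.count ≤
      (∑' k, a k) * eLpNorm b q Measure.count := by
  have h := eLpNorm_lintegral_conv_le (μ := (Measure.count : Measure (Fin n → ℤ)))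
    (k := a) (F := b) Measurable.of_discrete Measurable.of_discrete.aemeasurable
    (by rwa [lintegral_count]) hq
  simpa only [lintegral_count] using h

theorem eLpNorm_count_sub {q : ℝ≥0∞} (a : (Fin n → ℤ) → ℝ≥0∞) (r : Fin n → ℤ) :
    eLpNorm (fun m => a (m - r)) q Measure.count = eLpNorm a q Measure.count :=
  eLpNorm_comp_measurePreserving (g := a) Measurable.of_discrete.aestronglyMeasurable
    (measurePreserving_sub_right Measure.count r)

/-- The discrete convolution estimate behind the algebra property. -/
theorem eLpNorm_weight_conv_le {s : ℝ} (hs : 1 < s) {q : ℝ≥0∞} (hq : 1 ≤ q)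
    (R : Finset (Fin n → ℤ)) : ∃ C : ℝ≥0∞, C < ⊤ ∧ ∀ a b : (Fin n → ℤ) → ℝ≥0∞,
      eLpNorm (fun k => (weight s k : ℝ≥0∞) * a k) q Measure.count < ⊤ →
      eLpNorm (fun k => (weight s k : ℝ≥0∞) * b k) q Measure.count < ⊤ →
      eLpNorm (fun m => (weight s m : ℝ≥0∞) * ∑ r ∈ R, ∑' k, a (m - r - k) * b k) q
        Measure.count ≤ C * eLpNorm (fun k => (weight s k : ℝ≥0∞) * a k) q Measure.count *
          eLpNorm (fun k => (weight s k : ℝ≥0∞) * b k) q Measure.count := by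
  set G : ℝ≥0∞ := ∑' k : Fin n → ℤ, egain s k with hG
  have hGt : G < ⊤ := tsum_egain_lt_top hs
  refine ⟨(∑ r ∈ R, (weight s r : ℝ≥0∞)) * (2 * G), ?_, fun a b ha hb => ?_⟩
  · exact ENNReal.mul_lt_top (ENNReal.sum_lt_top.2 fun r _ => ENNReal.coe_lt_top)
      (ENNReal.mul_lt_top (by simp) hGt)
  set A : (Fin n → ℤ) → ℝ≥0∞ := fun k => (weight s k : ℝ≥0∞) * a k with hA
  set B : (Fin n → ℤ) → ℝ≥0∞ := fun k => (weight s k : ℝ≥0∞) * b k with hB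
  have hsum (F : (Fin n → ℤ) → ℝ≥0∞) :
      ∑' k, egain s k * F k ≤ G * eLpNorm F q Measure.count := by
    rw [hG, ← ENNReal.tsum_mul_right]
    refine ENNReal.tsum_le_tsum fun k => ?_
    gcongr
    simpa using enorm_le_eLpNorm_count F k (one_pos.trans_le hq).ne'
  have hswap (F H : (Fin n → ℤ) → ℝ≥0∞) (m : Fin n → ℤ) :
      ∑' k, F (m - k) * H k = ∑' k, H (m - k) * F k := by
    rw [← (Equiv.subLeft m).tsum_eq]
    refine tsum_congr fun k => ?_
    simp [mul_comm]
  -- `weight_le` splits the sum into `(gain · A) * B` and `A * (gain · B)`; `hswap` puts the factor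
  -- carrying the gain first in both.
  have hpt (m : Fin n → ℤ) : (weight s m : ℝ≥0∞) * ∑ r ∈ R, ∑' k, a (m - r - k) * b k ≤
      ∑ r ∈ R, (weight s r : ℝ≥0∞) * ((∑' k, (egain s (m - r - k) * A (m - r - k)) * B k) +
        ∑' k, (egain s (m - r - k) * B (m - r - k)) * A k) := by
    rw [Finset.mul_sum]
    refine Finset.sum_le_sum fun r _ => ?_
    rw [hswap (fun k => egain s k * B k) A (m - r), ← ENNReal.tsum_add, ← ENNReal.tsum_mul_left,
      ← ENNReal.tsum_mul_left]
    refine ENNReal.tsum_le_tsum fun k => ?_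
    calc (weight s m : ℝ≥0∞) * (a (m - r - k) * b k)
        ≤ (weight s r * (weight s (m - r - k) * weight s k *
            (egain s (m - r - k) + egain s k))) * (a (m - r - k) * b k) := by
          gcongr
          exact weight_le hs _ _ _ _ (by abel)
      _ = _ := by simp only [hA, hB]; ring
  -- The gain makes the first factor summable, with `ℓ^1` norm at most `G ‖F‖_q`, so that Young's
  -- inequality applies.
  have hY (F H : (Fin n → ℤ) → ℝ≥0∞) (hF : eLpNorm F q Measure.count < ⊤) (r : Fin n → ℤ) :
      eLpNorm (fun m => ∑' k, (egain s (m - r - k) * F (m - r - k)) * H k) q Measure.count ≤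
        G * eLpNorm F q Measure.count * eLpNorm H q Measure.count := by
    rw [eLpNorm_count_sub (fun m => ∑' k, (egain s (m - k) * F (m - k)) * H k) r]
    refine (eLpNorm_count_conv_le hq (fun k => egain s k * F k) H
      ((hsum F).trans_lt (ENNReal.mul_lt_top hGt hF)).ne).trans ?_
    gcongr
    exact hsum F
  have hmeas (F : (Fin n → ℤ) → ℝ≥0∞) : AEStronglyMeasurable F Measure.count :=
    Measurable.of_discrete.aestronglyMeasurable
  calc eLpNorm (fun m => (weight s m : ℝ≥0∞) * ∑ r ∈ R, ∑' k, a (m - r - k) * b k) q Measure.count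
      ≤ eLpNorm (∑ r ∈ R, fun m => (weight s r : ℝ≥0∞) *
          ((∑' k, (egain s (m - r - k) * A (m - r - k)) * B k) +
            ∑' k, (egain s (m - r - k) * B (m - r - k)) * A k)) q Measure.count := by
        refine eLpNorm_mono_enorm fun m => ?_
        simp only [enorm_eq_self, Finset.sum_apply]
        exact hpt m
    _ ≤ ∑ r ∈ R, eLpNorm (fun m => (weight s r : ℝ≥0∞) *
          ((∑' k, (egain s (m - r - k) * A (m - r - k)) * B k) +
            ∑' k, (egain s (m - r - k) * B (m - r - k)) * A k)) q Measure.count :=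
        eLpNorm_sum_le (fun r _ => hmeas _) hq
    _ ≤ ∑ r ∈ R, (weight s r : ℝ≥0∞) * (2 * G * eLpNorm A q Measure.count *
          eLpNorm B q Measure.count) := by
        refine Finset.sum_le_sum fun r _ => ?_
        refine (eLpNorm_le_nnreal_smul_eLpNorm_of_ae_le_mul' (c := weight s r)
          (g := (fun m => ∑' k, (egain s (m - r - k) * A (m - r - k)) * B k) +
            fun m => ∑' k, (egain s (m - r - k) * B (m - r - k)) * A k)
          (Filter.Eventually.of_forall fun m => by simp) q).trans ?_
        rw [ENNReal.smul_def, smul_eq_mul]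
        gcongr
        refine (eLpNorm_add_le (hmeas _) (hmeas _) hq).trans ?_
        refine (add_le_add (hY A B ha r) (hY B A hb r)).trans_eq ?_
        ring
    _ = _ := by
        rw [← Finset.sum_mul]
        ring

end Weight



/-! ### Reconstruction, completeness, and the product estimate. -/

section Space

variable {n : ℕ} {ρ : E n → ℝ} {p : ℝ≥0∞} [hp : Fact (1 ≤ p)]

/-- The operator `□_k` on `L^p`. -/
def boxLp (hρ : IsWindow ρ) (k : Fin n → ℤ) :
    Lp ℂ p (volume : Measure (E n)) →L[ℂ] Lp ℂ p (volume : Measure (E n)) :=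
  multLp (boxSymbol hρ k)

theorem toTD_boxLp (hρ : IsWindow ρ) (k : Fin n → ℤ) (f : Lp ℂ p (volume : Measure (E n))) :
    (boxLp hρ k f : 𝓢'(E n, ℂ)) = box ρ k (f : 𝓢'(E n, ℂ)) := by
  rw [box_eq hρ, boxLp, toTD_multLp]

theorem lpENorm_box (hρ : IsWindow ρ) (k : Fin n → ℤ) (f : Lp ℂ p (volume : Measure (E n))) :
    lpENorm p (box ρ k (f : 𝓢'(E n, ℂ))) = ‖boxLp hρ k f‖ₑ := by
  rw [← toTD_boxLp hρ, lpENorm_toTD]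

theorem gmENorm_eq (hρ : IsWindow ρ) (s : ℝ) (q : ℝ≥0∞) (f : Lp ℂ p (volume : Measure (E n))) :
    gmENorm ρ s p q f =
      eLpNorm (fun k => (weight s k : ℝ≥0∞) * ‖boxLp hρ k f‖ₑ) q Measure.count := by
  simp only [gmENorm, lpENorm_box hρ]

theorem toTD_sum {ι : Type*} (t : Finset ι) (F : ι → Lp ℂ p (volume : Measure (E n))) :
    ((∑ i ∈ t, F i : Lp ℂ p (volume : Measure (E n))) : 𝓢'(E n, ℂ)) =
      ∑ i ∈ t, (F i : 𝓢'(E n, ℂ)) :=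
  map_sum (Lp.toTemperedDistributionCLM ℂ volume p) F t

theorem toTD_hasSum {ι : Type*} {F : ι → Lp ℂ p (volume : Measure (E n))}
    {f : Lp ℂ p (volume : Measure (E n))} (h : HasSum F f) :
    HasSum (fun i => (F i : 𝓢'(E n, ℂ))) (f : 𝓢'(E n, ℂ)) :=
  (Lp.toTemperedDistributionCLM ℂ (volume : Measure (E n)) p).hasSum h

theorem summable_of_tsum_enorm_ne_top {ι F : Type*} [NormedAddCommGroup F] [CompleteSpace F]
    {u : ι → F} (h : ∑' i, ‖u i‖ₑ ≠ ⊤) : Summable u :=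
  Summable.of_nnnorm (ENNReal.tsum_coe_ne_top_iff_summable.1 h)

theorem enorm_le_tsum_of_hasSum {ι F : Type*} [NormedAddCommGroup F]
    {u : ι → F} {f : F} (h : HasSum u f) : ‖f‖ₑ ≤ ∑' i, ‖u i‖ₑ := by
  rw [← h.tsum_eq]
  exact enorm_tsum_le_tsum_enorm

/-- The support of `σ_m` is bounded, so it meets only finitely many supports of the `σ_k`, and these
`σ_k` add up to one there. -/
theorem sum_boxLp_boxLp (hρ : IsWindow ρ) (m : Fin n → ℤ) (f : Lp ℂ p (volume : Measure (E n))) :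
    ∃ t : Finset (Fin n → ℤ), (∀ k ∉ t, boxLp hρ m (boxLp hρ k f) = 0) ∧
      ∑ k ∈ t, boxLp hρ m (boxLp hρ k f) = boxLp hρ m f := by
  obtain ⟨N, hN⟩ := exists_nat_ge (‖latticePt m‖ + √n)
  have hsupp (ζ : E n) (h : boxSymbol hρ m ζ ≠ 0) : ‖(2 * Real.pi) • ζ‖ ≤ N := by
    have h1 : ‖(2 * Real.pi) • ζ - latticePt m‖ ≤ √n :=
      norm_le_sqrt_of_abs_le_one fun i => by
        simpa using abs_sub_le_one_of_boxSymbol hρ h i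
    have h2 := norm_add_le ((2 * Real.pi) • ζ - latticePt m) (latticePt m)
    rw [sub_add_cancel] at h2
    linarith
  refine ⟨cube n (N + 1), fun k hk => ?_, ?_⟩
  · have h0 : ∀ ζ, boxSymbol hρ k ζ * boxSymbol hρ m ζ = (0 : 𝓢(E n, ℂ)) ζ := fun ζ => by
      by_contra h
      have h1 := left_ne_zero_of_mul (h : boxSymbol hρ k ζ * boxSymbol hρ m ζ ≠ 0)
      have h2 := right_ne_zero_of_mul (h : boxSymbol hρ k ζ * boxSymbol hρ m ζ ≠ 0)
      refine hk (hρ.mem_cube (hsupp ζ h2) fun h3 => h1 ?_)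
      rw [boxSymbol_apply, sigma_eq_div, h3, zero_div, Complex.ofReal_zero]
    rw [boxLp, boxLp, multLp_mul _ _ f h0]
    apply toTD_injective
    rw [toTD_multLp, toTD_zero]
    ext φ
    have : ((0 : 𝓢(E n, ℂ)) : E n → ℂ) = fun _ => 0 := rfl
    rw [this, TemperedDistribution.fourierMultiplierCLM_const, zero_smul]
    rfl
  · apply toTD_injective
    rw [toTD_sum]
    simp only [boxLp, toTD_multLp]
    simp only [TemperedDistribution.fourierMultiplierCLM_fourierMultiplierCLM_apply
      (boxSymbol hρ _).hasTemperateGrowth (boxSymbol hρ m).hasTemperateGrowth]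
    have hg (k : Fin n → ℤ) : ((boxSymbol hρ k : E n → ℂ) *
        (boxSymbol hρ m : E n → ℂ)).HasTemperateGrowth :=
      (boxSymbol hρ k).hasTemperateGrowth.mul (boxSymbol hρ m).hasTemperateGrowth
    rw [← sum_apply,
      ← TemperedDistribution.fourierMultiplierCLM_sum ℂ fun k _ => hg k]
    congr 2
    ext ζ
    simp only [Pi.mul_apply]
    rw [← Finset.sum_mul]
    by_cases h : boxSymbol hρ m ζ = 0
    · simp [h]
    · simp only [boxSymbol_apply hρ]
      rw [← Complex.ofReal_sum, hρ.sum_sigma (hsupp ζ h)]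
      simp

/-- Reconstruction of a function from its frequency-uniform decomposition. -/
theorem hasSum_boxLp (hρ : IsWindow ρ) {f : Lp ℂ p (volume : Measure (E n))}
    (hf : ∑' k, ‖boxLp hρ k f‖ₑ ≠ ⊤) : HasSum (fun k => boxLp hρ k f) f := by
  have hs := (summable_of_tsum_enorm_ne_top hf).hasSum
  set F := ∑' k, boxLp hρ k f
  -- Absolute convergence provides some limit `F`; its boxes agree with those of `f`, and
  -- injectivity identifies the two. No density of nice functions in `L^p` is used, so `p = ⊤` is
  -- included.
  have h0 : F - f = 0 := by
    refine eq_zero_of_box_eq_zero hρ fun m => ?_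
    rw [← toTD_boxLp hρ, map_sub]
    obtain ⟨t, ht, hsum⟩ := sum_boxLp_boxLp hρ m f
    have h1 := (boxLp hρ m).hasSum hs
    rw [← h1.tsum_eq, tsum_eq_sum ht]
    erw [hsum]
    rw [sub_self, toTD_zero]
  rwa [sub_eq_zero.1 h0] at hs

variable {s : ℝ} {q : ℝ≥0∞}

/-- Lower semicontinuity of the Gevrey-modulation norm. -/
theorem gmENorm_le_liminf (hρ : IsWindow ρ) {u : ℕ → Lp ℂ p (volume : Measure (E n))}
    {f : Lp ℂ p (volume : Measure (E n))} (hu : Filter.Tendsto u Filter.atTop (nhds f)) :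
    gmENorm ρ s p q f ≤ Filter.liminf (fun l => gmENorm ρ s p q (u l)) Filter.atTop := by
  have hreal (g : Lp ℂ p (volume : Measure (E n))) : gmENorm ρ s p q g =
      eLpNorm (fun k => (weight s k : ℝ) * ‖boxLp hρ k g‖) q Measure.count := by
    rw [gmENorm_eq hρ]
    refine eLpNorm_congr_enorm_ae (Filter.Eventually.of_forall fun k => ?_)
    simp [enorm_eq_nnnorm]
  simp only [hreal]
  refine Lp.eLpNorm_lim_le_liminf_eLpNorm
    (fun l => Measurable.of_discrete.aestronglyMeasurable) _
    (Filter.Eventually.of_forall fun k => ?_)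
  exact (((boxLp hρ k).continuous.tendsto f).comp hu).norm.const_mul _

variable [hq : Fact (1 ≤ q)]

theorem tsum_boxLp_le (hρ : IsWindow ρ) (f : Lp ℂ p (volume : Measure (E n))) :
    ∑' k, ‖boxLp hρ k f‖ₑ ≤
      (∑' k : Fin n → ℤ, (weight s k : ℝ≥0∞)⁻¹) * gmENorm ρ s p q f := by
  rw [gmENorm_eq hρ]
  exact tsum_le_eLpNorm_weight hq.out _

theorem tsum_boxLp_ne_top (hρ : IsWindow ρ) (hs : 1 < s) {f : Lp ℂ p (volume : Measure (E n))}
    (hf : gmENorm ρ s p q f < ⊤) : ∑' k, ‖boxLp hρ k f‖ₑ ≠ ⊤ :=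
  ((tsum_boxLp_le hρ f).trans_lt (ENNReal.mul_lt_top (tsum_inv_weight_lt_top hs) hf)).ne

theorem enorm_le_gmENorm (hρ : IsWindow ρ) (hs : 1 < s) {f : Lp ℂ p (volume : Measure (E n))}
    (hf : gmENorm ρ s p q f < ⊤) :
    ‖f‖ₑ ≤ (∑' k : Fin n → ℤ, (weight s k : ℝ≥0∞)⁻¹) * gmENorm ρ s p q f := by
  have h := hasSum_boxLp hρ (tsum_boxLp_ne_top hρ hs hf)
  exact (enorm_le_tsum_of_hasSum h).trans (tsum_boxLp_le hρ f)

theorem gmNorm_apply (f : GM ρ s p q) : gmNorm ρ s p q f = (gmENorm ρ s p q f.1).toReal := rfl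

theorem norm_le_gmNorm (hρ : IsWindow ρ) (hs : 1 < s) (f : GM ρ s p q) :
    ‖f.1‖ ≤ (∑' k : Fin n → ℤ, (weight s k : ℝ≥0∞)⁻¹).toReal * gmNorm ρ s p q f := by
  rw [gmNorm_apply, ← ENNReal.toReal_mul, ← toReal_enorm]
  exact ENNReal.toReal_mono
    (ENNReal.mul_lt_top (tsum_inv_weight_lt_top hs) (GM_lt_top f)).ne
    (enorm_le_gmENorm hρ hs (GM_lt_top f))

theorem eq_zero_of_gmNorm_eq_zero (hρ : IsWindow ρ) (hs : 1 < s) {f : GM ρ s p q}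
    (hf : gmNorm ρ s p q f = 0) : f = 0 := by
  have h := norm_le_gmNorm hρ hs f
  rw [hf, mul_zero] at h
  exact Subtype.ext (norm_le_zero_iff.1 h)

theorem exists_tendsto_gmNorm (hρ : IsWindow ρ) (hs : 1 < s) (u : ℕ → GM ρ s p q)
    (hu : ∀ ε : ℝ, 0 < ε → ∃ N : ℕ, ∀ m ≥ N, ∀ l ≥ N, gmNorm ρ s p q (u m - u l) < ε) :
    ∃ f : GM ρ s p q,
      Filter.Tendsto (fun m => gmNorm ρ s p q (u m - f)) Filter.atTop (nhds 0) := by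
  set C := (∑' k : Fin n → ℤ, (weight s k : ℝ≥0∞)⁻¹).toReal
  have hcau : CauchySeq fun m => (u m).1 := by
    rw [Metric.cauchySeq_iff]
    intro ε hε
    have hC : 0 < C + 1 := by positivity
    obtain ⟨N, hN⟩ := hu (ε / (C + 1)) (by positivity)
    refine ⟨N, fun m hm l hl => ?_⟩
    rw [dist_eq_norm]
    have h1 := norm_le_gmNorm hρ hs (u m - u l)
    have h2 := hN m hm l hl
    rw [lt_div_iff₀ hC] at h2
    have h3 : 0 ≤ gmNorm ρ s p q (u m - u l) := apply_nonneg _ _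
    change ‖(u m).1 - (u l).1‖ ≤ _ at h1
    linarith
  obtain ⟨f, hf⟩ := cauchySeq_tendsto_of_complete hcau
  have key (ε : ℝ) (hε : 0 < ε) : ∃ N : ℕ, ∀ m ≥ N,
      gmENorm ρ s p q ((u m).1 - f) ≤ ENNReal.ofReal ε := by
    obtain ⟨N, hN⟩ := hu ε hε
    refine ⟨N, fun m hm => ?_⟩
    -- With `m` fixed, `u m - u l` tends to `u m - f` in `L^p` as `l → ∞`, and lower semicontinuity
    -- transfers the Cauchy bound to the limit.
    refine (gmENorm_le_liminf hρ (hf.const_sub (u m).1)).trans ?_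
    refine Filter.liminf_le_of_frequently_le' (Filter.Eventually.frequently ?_)
    filter_upwards [Filter.eventually_ge_atTop N] with l hl
    have h1 := (hN m hm l hl).le
    rw [gmNorm_apply] at h1
    exact ENNReal.le_ofReal_iff_toReal_le (GM_lt_top (u m - u l)).ne hε.le |>.2 h1
  obtain ⟨N₀, hN₀⟩ := key 1 one_pos
  have hmem : f ∈ GM ρ s p q := by
    have h1 : (u N₀).1 - f ∈ GM ρ s p q := (hN₀ N₀ le_rfl).trans_lt ENNReal.ofReal_lt_top
    have h2 := (GM ρ s p q).sub_mem (u N₀).2 h1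
    rwa [sub_sub_cancel] at h2
  refine ⟨⟨f, hmem⟩, ?_⟩
  rw [Metric.tendsto_atTop]
  intro ε hε
  obtain ⟨N, hN⟩ := key (ε / 2) (by positivity)
  refine ⟨N, fun m hm => ?_⟩
  rw [Real.dist_eq, sub_zero, abs_of_nonneg (apply_nonneg _ _), gmNorm_apply]
  have h1 := ENNReal.toReal_mono ENNReal.ofReal_ne_top (hN m hm)
  rw [ENNReal.toReal_ofReal (by positivity)] at h1
  exact h1.trans_lt (by linarith)

/-- Two different exponents are allowed, in order to identify a sum formed in `L^∞` with one formed
in `L^p`. -/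
theorem ae_eq_of_toTD_eq {r : ℝ≥0∞} [hr : Fact (1 ≤ r)] {f : Lp ℂ p (volume : Measure (E n))}
    {g : Lp ℂ r (volume : Measure (E n))} (h : (f : 𝓢'(E n, ℂ)) = (g : 𝓢'(E n, ℂ))) :
    f =ᵐ[volume] g := by
  refine ae_eq_of_integral_contDiff_smul_eq ((Lp.memLp f).locallyIntegrable hp.out)
    ((Lp.memLp g).locallyIntegrable hr.out) fun φ hφ hc => ?_
  have hc' : HasCompactSupport (Complex.ofRealCLM ∘ φ) := hc.comp_left rfl
  have hs' : ContDiff ℝ ∞ (Complex.ofRealCLM ∘ φ) := by fun_prop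
  have h1 := congrArg (fun T : 𝓢'(E n, ℂ) => T (hc'.toSchwartzMap hs')) h
  simpa using h1

/-- `□_k` as a map from `L^p` to `L^∞`. -/
def boxTop (hρ : IsWindow ρ) (k : Fin n → ℤ) (f : Lp ℂ p (volume : Measure (E n))) :
    Lp ℂ ⊤ (volume : Measure (E n)) :=
  multTop (boxSymbol hρ k) f

/-- Applying `fatSymbol k` after `□_k` changes nothing, so Bernstein's inequality for that symbol
bounds the `L^∞` norm by `‖□_k f‖_p` itself rather than by `‖f‖_p`, with a constant free of `k`. -/
theorem enorm_boxTop_le (hρ : IsWindow ρ) (k : Fin n → ℤ)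
    (f : Lp ℂ p (volume : Measure (E n))) : ‖boxTop hρ k f‖ₑ ≤
      eLpNorm (FourierTransformInv.fourierInv (fatSymbol 0) : 𝓢(E n, ℂ)) (1 - p⁻¹)⁻¹ volume *
        ‖boxLp hρ k f‖ₑ := by
  rw [boxTop, ← multTop_mul (boxSymbol hρ k) (fatSymbol k) f (boxSymbol_mul_fatSymbol hρ k)]
  refine (enorm_multTop_le _ _).trans_eq ?_
  rw [fatSymbol, eLpNorm_fourierInv_symbol]
  rfl

theorem enorm_boxLp_le (hρ : IsWindow ρ) (k : Fin n → ℤ)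
    (f : Lp ℂ p (volume : Measure (E n))) : ‖boxLp hρ k f‖ₑ ≤
      eLpNorm (FourierTransformInv.fourierInv (boxSymbol hρ 0) : 𝓢(E n, ℂ)) 1 volume * ‖f‖ₑ := by
  refine (enorm_multLp_le _ _).trans_eq ?_
  rw [boxSymbol, eLpNorm_fourierInv_symbol]
  rfl

variable (n p) in
/-- The pointwise product `L^∞ × L^p → L^p`. -/
def prodLp : Lp ℂ ⊤ (volume : Measure (E n)) →L[ℂ] Lp ℂ p (volume : Measure (E n)) →L[ℂ]
    Lp ℂ p (volume : Measure (E n)) :=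
  (ContinuousLinearMap.mul ℂ ℂ).holderL volume ⊤ p p

theorem prodLp_ae (f : Lp ℂ ⊤ (volume : Measure (E n))) (g : Lp ℂ p (volume : Measure (E n))) :
    prodLp n p f g =ᵐ[volume] fun x => f x * g x :=
  (ContinuousLinearMap.mul ℂ ℂ).coeFn_holder f g

theorem enorm_prodLp_le (f : Lp ℂ ⊤ (volume : Measure (E n)))
    (g : Lp ℂ p (volume : Measure (E n))) : ‖prodLp n p f g‖ₑ ≤ ‖f‖ₑ * ‖g‖ₑ := by
  have h := (ContinuousLinearMap.mul ℂ ℂ).nnnorm_holder_apply_apply_le (r := p) f g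
  have h1 : ‖ContinuousLinearMap.mul ℂ ℂ‖₊ = 1 := by
    ext; simp
  rw [h1, one_mul] at h
  simp only [enorm_eq_nnnorm]
  exact_mod_cast h

theorem boxLp_prodLp_eq_zero (hρ : IsWindow ρ) {k l m : Fin n → ℤ} (hm : m - k - l ∉ cube n 3)
    (f g : Lp ℂ p (volume : Measure (E n))) :
    boxLp hρ m (prodLp n p (boxTop hρ k f) (boxLp hρ l g)) = 0 := by
  refine multLp_mul_eq_zero (boxSymbol_add_eq_zero hρ hm) f g ?_
  filter_upwards [prodLp_ae (boxTop hρ k f) (boxLp hρ l g), multTop_ae (boxSymbol hρ k) f,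
    multLp_ae (boxSymbol hρ l) g] with x h1 h2 h3
  rw [h1, boxTop, boxLp, h2, h3]

theorem tsum_indicator_cube (R : Finset (Fin n → ℤ)) (a : (Fin n → ℤ) → ℝ≥0∞)
    (j : Fin n → ℤ) :
    ∑' k, (if j - k ∈ R then a k else 0) = ∑ r ∈ R, a (j - r) := by
  rw [← (Equiv.subLeft j).tsum_eq, tsum_eq_sum (s := R)]
  · refine Finset.sum_congr rfl fun r hr => ?_
    simp [hr]
  · intro r hr
    simp [hr]

theorem exists_prod (hρ : IsWindow ρ) (hs : 1 < s) (f g : GM ρ s p q) :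
    ∃ h : Lp ℂ p (volume : Measure (E n)), (h =ᵐ[volume] fun x => f.1 x * g.1 x) ∧
      ∀ m, ‖boxLp hρ m h‖ₑ ≤
        (eLpNorm (FourierTransformInv.fourierInv (boxSymbol hρ 0) : 𝓢(E n, ℂ)) 1 volume *
        eLpNorm (FourierTransformInv.fourierInv (fatSymbol 0) : 𝓢(E n, ℂ)) (1 - p⁻¹)⁻¹ volume) *
        ∑ r ∈ cube n 3, ∑' l, ‖boxLp hρ (m - r - l) f.1‖ₑ * ‖boxLp hρ l g.1‖ₑ := by
  set K₁ := eLpNorm (FourierTransformInv.fourierInv (boxSymbol hρ 0) : 𝓢(E n, ℂ)) 1 volume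
  set K₂ := eLpNorm (FourierTransformInv.fourierInv (fatSymbol 0) : 𝓢(E n, ℂ))
    (1 - p⁻¹)⁻¹ volume with hK₂
  have hK₂t : K₂ ≠ ⊤ := (SchwartzMap.eLpNorm_lt_top _ _ _).ne
  have hf := tsum_boxLp_ne_top hρ hs (GM_lt_top f)
  have hU : ∑' k, ‖boxTop hρ k f.1‖ₑ ≠ ⊤ := by
    refine ((ENNReal.tsum_le_tsum fun k => enorm_boxTop_le hρ k f.1).trans_lt ?_).ne
    rw [ENNReal.tsum_mul_left]
    exact ENNReal.mul_lt_top hK₂t.lt_top hf.lt_top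
  have hUs := (summable_of_tsum_enorm_ne_top hU).hasSum
  set F := ∑' k, boxTop hρ k f.1
  -- The sum of the boxes in `L^∞` and the sum in `L^p` have the same terms as distributions, so `f`
  -- is essentially bounded.
  have hFf : F =ᵐ[volume] f.1 := by
    apply ae_eq_of_toTD_eq
    have h1 := toTD_hasSum hUs
    have h2 := toTD_hasSum (hasSum_boxLp hρ hf)
    have h3 (k : Fin n → ℤ) : (boxTop hρ k f.1 : 𝓢'(E n, ℂ)) =
        (boxLp hρ k f.1 : 𝓢'(E n, ℂ)) := by
      rw [boxTop, boxLp, toTD_multTop, toTD_multLp]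
    simp only [h3] at h1
    exact h1.unique h2
  have hVs := hasSum_boxLp hρ (tsum_boxLp_ne_top hρ hs (GM_lt_top g))
  refine ⟨prodLp n p F g.1, ?_, fun m => ?_⟩
  · filter_upwards [prodLp_ae F g.1, hFf] with x h1 h2
    rw [h1, h2]
  · have h1 := ((boxLp hρ m).comp (prodLp n p F)).hasSum hVs
    have h2 (l : Fin n → ℤ) :=
      ((boxLp hρ m).comp ((prodLp n p).flip (boxLp hρ l g.1))).hasSum hUs
    -- The pairs outside the cube drop out by the support of the spectrum; the others are estimated
    -- by the uniform bound for `□_m`, Hölder's inequality and Bernstein's inequality.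
    have h3 (k l : Fin n → ℤ) : ‖boxLp hρ m (prodLp n p (boxTop hρ k f.1) (boxLp hρ l g.1))‖ₑ ≤
        if m - l - k ∈ cube n 3 then K₁ * K₂ * (‖boxLp hρ k f.1‖ₑ * ‖boxLp hρ l g.1‖ₑ) else 0 := by
      split_ifs with hm
      · refine (enorm_boxLp_le hρ m _).trans ?_
        rw [mul_assoc]
        gcongr
        refine (enorm_prodLp_le _ _).trans ?_
        rw [← mul_assoc]
        gcongr
        exact enorm_boxTop_le hρ k f.1
      · rw [boxLp_prodLp_eq_zero hρ (by rwa [sub_right_comm]), enorm_zero]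
    calc ‖boxLp hρ m (prodLp n p F g.1)‖ₑ
        ≤ ∑' l, ‖boxLp hρ m (prodLp n p F (boxLp hρ l g.1))‖ₑ := enorm_le_tsum_of_hasSum h1
      _ ≤ ∑' l, ∑' k, ‖boxLp hρ m (prodLp n p (boxTop hρ k f.1) (boxLp hρ l g.1))‖ₑ :=
          ENNReal.tsum_le_tsum fun l => enorm_le_tsum_of_hasSum (h2 l)
      _ ≤ ∑' l, ∑' k, if m - l - k ∈ cube n 3 then
            K₁ * K₂ * (‖boxLp hρ k f.1‖ₑ * ‖boxLp hρ l g.1‖ₑ) else 0 :=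
          ENNReal.tsum_le_tsum fun l => ENNReal.tsum_le_tsum fun k => h3 k l
      _ = ∑' l, ∑ r ∈ cube n 3,
            K₁ * K₂ * (‖boxLp hρ (m - l - r) f.1‖ₑ * ‖boxLp hρ l g.1‖ₑ) :=
          tsum_congr fun l => tsum_indicator_cube _ _ _
      _ = _ := by
          rw [Summable.tsum_finsetSum fun r _ => ENNReal.summable, Finset.mul_sum]
          refine Finset.sum_congr rfl fun r _ => ?_
          rw [ENNReal.tsum_mul_left]
          simp only [sub_right_comm m r]

theorem exists_gmNorm_prod_le (hρ : IsWindow ρ) (hs : 1 < s) :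
    ∃ C : ℝ, 0 < C ∧ ∀ f g : GM ρ s p q, ∃ h : GM ρ s p q,
      (h.1 =ᵐ[volume] fun x => f.1 x * g.1 x) ∧
      gmNorm ρ s p q h ≤ C * gmNorm ρ s p q f * gmNorm ρ s p q g := by
  obtain ⟨C₀, hC₀, hC⟩ := eLpNorm_weight_conv_le (n := n) hs hq.out (cube n 3)
  set K := eLpNorm (FourierTransformInv.fourierInv (boxSymbol hρ 0) : 𝓢(E n, ℂ)) 1 volume *
    eLpNorm (FourierTransformInv.fourierInv (fatSymbol 0) : 𝓢(E n, ℂ)) (1 - p⁻¹)⁻¹ volume with hK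
  have hKt : K ≠ ⊤ := ENNReal.mul_ne_top (SchwartzMap.eLpNorm_lt_top _ _ _).ne
    (SchwartzMap.eLpNorm_lt_top _ _ _).ne
  -- The summand `1` only ensures that the constant is positive.
  refine ⟨(K * C₀).toReal + 1, by positivity, fun f g => ?_⟩
  obtain ⟨h, hae, hbox⟩ := exists_prod hρ hs f g
  rw [← hK] at hbox
  have hle : gmENorm ρ s p q h ≤ K * C₀ * gmENorm ρ s p q f.1 * gmENorm ρ s p q g.1 := by
    have h1 := hC (fun k => ‖boxLp hρ k f.1‖ₑ) (fun k => ‖boxLp hρ k g.1‖ₑ)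
      (by rw [← gmENorm_eq]; exact GM_lt_top f) (by rw [← gmENorm_eq]; exact GM_lt_top g)
    rw [← gmENorm_eq, ← gmENorm_eq] at h1
    rw [gmENorm_eq hρ, mul_assoc K, mul_assoc K]
    refine (eLpNorm_le_nnreal_smul_eLpNorm_of_ae_le_mul' (c := K.toNNReal)
      (g := fun m => (weight s m : ℝ≥0∞) * ∑ r ∈ cube n 3, ∑' l,
        ‖boxLp hρ (m - r - l) f.1‖ₑ * ‖boxLp hρ l g.1‖ₑ)
      (Filter.Eventually.of_forall fun m => ?_) q).trans ?_
    · simp only [enorm_eq_self]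
      rw [ENNReal.coe_toNNReal hKt, mul_left_comm]
      gcongr
      exact hbox m
    · rw [ENNReal.smul_def, smul_eq_mul, ENNReal.coe_toNNReal hKt]
      gcongr
  have htop : K * C₀ * gmENorm ρ s p q f.1 * gmENorm ρ s p q g.1 < ⊤ :=
    ENNReal.mul_lt_top (ENNReal.mul_lt_top (ENNReal.mul_lt_top hKt.lt_top hC₀) (GM_lt_top f))
      (GM_lt_top g)
  refine ⟨⟨h, hle.trans_lt htop⟩, hae, ?_⟩
  rw [gmNorm_apply, gmNorm_apply, gmNorm_apply]
  refine (ENNReal.toReal_mono htop.ne hle).trans ?_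
  rw [ENNReal.toReal_mul, ENNReal.toReal_mul]
  gcongr
  linarith

end Space

end GevreyModulation

end

/-- For `s > 1` and `1 ≤ p, q ≤ ∞`, the Gevrey-modulation space is a Banach algebra under pointwise
multiplication: it is a Banach space, and the pointwise product is a bounded operation on it. -/
theorem mainTheorem2 (n : ℕ) (ρ : GevreyModulation.E n → ℝ) (hρ : GevreyModulation.IsWindow ρ)
    (s : ℝ) (hs : 1 < s) (p q : ℝ≥0∞) [Fact (1 ≤ p)] [Fact (1 ≤ q)] :
    -- the seminorm `gmNorm` is a norm
    (∀ f : GevreyModulation.GM ρ s p q, GevreyModulation.gmNorm ρ s p q f = 0 → f = 0) ∧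
    -- which is complete
    (∀ u : ℕ → GevreyModulation.GM ρ s p q,
      (∀ ε : ℝ, 0 < ε → ∃ N : ℕ, ∀ m ≥ N, ∀ l ≥ N,
        GevreyModulation.gmNorm ρ s p q (u m - u l) < ε) →
      ∃ f : GevreyModulation.GM ρ s p q,
        Filter.Tendsto (fun m => GevreyModulation.gmNorm ρ s p q (u m - f)) Filter.atTop
          (nhds 0)) ∧
    -- and the space is closed under pointwise products, with a norm estimate
    (∃ C : ℝ, 0 < C ∧ ∀ f g : GevreyModulation.GM ρ s p q, ∃ h : GevreyModulation.GM ρ s p q,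
      (∀ᵐ x ∂(volume : Measure (GevreyModulation.E n)),
        (h : Lp ℂ p (volume : Measure (GevreyModulation.E n))) x =
          (f : Lp ℂ p (volume : Measure (GevreyModulation.E n))) x *
            (g : Lp ℂ p (volume : Measure (GevreyModulation.E n))) x) ∧
      GevreyModulation.gmNorm ρ s p q h ≤
        C * GevreyModulation.gmNorm ρ s p q f * GevreyModulation.gmNorm ρ s p q g) := by
  exact ⟨fun f hf => GevreyModulation.eq_zero_of_gmNorm_eq_zero hρ hs hf,
    GevreyModulation.exists_tendsto_gmNorm hρ hs, GevreyModulation.exists_gmNorm_prod_le hρ hs⟩
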